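/- **Setting.** Let $\Omega$ be a nonempty set, $\mathbb K$ a nonempty set of maps $z:[0,\infty)\to\Omega$, and $g:\Omega\to[0,1]$ a function such that $t\mapsto g(z(t))$ is Lebesgue measurable for every $z\in\mathbb K$. Let $\mathfrak C$ and $\mathfrak U$ be the sets of all bounded real functions on $\mathbb K$ and on $\Omega$. A *game map* is a map $\mathbb V:\mathfrak C\to\mathfrak U$ with $\mathbb V[Ac+B]=A\,\mathbb V[c]+B$ for all $c\in\mathfrak C$, $A\ge 0$, $B\in\mathbb R$, and with $\mathbb V[c_1]\le\mathbb V[c_2]$ whenever $c_1\le c_2$. Let $\mathfrak D$ be the set of probability densities $\varrho:[0,\infty)\to[0,\infty)$. Put $c[\varrho](z)=\int_0^\infty\varrho(t)g(z(t))\,dt$, $\mathcal V[\varrho]=\mathbb V[c[\varrho]]$, $\varrho^{\lambda}_{\rm scale}(t)=\lambda\varrho(\lambda t)$, and, if $\int_T^\infty\varrho>0$, $\varrho^{T}_{\rm shift}(t)=\varrho(t+T)/\int_T^\infty\varrho(s)\,ds$ and $$dd(\varrho,T)(z)=\int_0^T\varrho(t)g(z(t))\,dt+\int_T^\infty\varrho(t)\,dt\cdot\mathcal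 V[\varrho^{T}_{\rm shift}](z(T)).$$ Let $V_a^b[y]$ be the total variation of $y$ on $[a,b)$, and for $r\in(0,1)$ let $q[\varrho](r)$ be the least positive number with $\int_0^{q[\varrho](r)}\varrho(t)\,dt=r$. Let $\varpi_T=\frac1T 1_{[0,T]}$ and $\pi_\lambda(t)=\lambda e^{-\lambda t}$. A density is a *power density* if it has the form $\varrho(t)=(\alpha+\beta t)^{-\gamma}$ with $\alpha,\beta,\gamma>0$. A density is *piecewise continuous on $(0,\infty)$* if it has finitely many discontinuities on each compact subinterval of $(0,\infty)$ and finite one-sided limits at each point of $(0,\infty)$. **Theorem.** Let $\mathbb V$ be a game map such that for every $\varkappa>0$ there is $\gamma>0$ with the property: for all $\nu\in\mathfrak D$ and $T>1$ with $V_0^\infty[\nu]<\gamma$ and $\int_0^T\nu(t)\,dt<1$, $$\bigl|\mathbb V[dd(\nu,T)](\omega)-\mathbb V[c[\nu]](\omega)\bigr|<\varkappa\qquad\forall\omega\in\Omega.$$ Let $U_*:\Omega\to[0,1]$ be arbitrary. Then the following conditions are equivalent (all limits are uniform in $\omega\in\Omega$): - $(c)$ for every density $\mu$ that is piecewise continuous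 on $(0,\infty)$, $\mathcal V[\mu^\lambda_{\rm scale}]\to U_*$ as $\lambda\to+0$; - $(u)$ $\mathcal V[\varpi_T]\to U_*$ as $T\to+\infty$; - $(e)$ $\mathcal V[\pi_\lambda]\to U_*$ as $\lambda\to+0$; - $(p)$ for some power density $\varrho$, $\mathcal V[\varrho^T_{\rm shift}]\to U_*$ as $T\to+\infty$; - $(q)$ for every power density $\varrho$, $\mathcal V[\varrho^T_{\rm shift}]\to U_*$ as $T\to+\infty$; - $(v)$ for every $\lambda_*>0$ and every family of densities $\mu_\lambda$, $\lambda\in(0,\lambda_*)$, with $\lim_{\lambda\to+0}\sup_{t>0}\mu_\lambda(t)=0$ and $$\sup_{\lambda\in(0,\lambda_*)}V_0^{q[\mu_\lambda](1-\varepsilon)}[\mu_\lambda]\cdot q[\mu_\lambda](1-\varepsilon)<+\infty\qquad\forall\varepsilon\in(0,1),$$ one has $\mathcal V[\mu_\lambda]\to U_*$ as $\lambda\to+0$; - $(\exists)$ there are $\lambda_*>0$ and a family of densities $\varrho_\lambda$, $\lambda\in(0,\lambda_*)$, such that 1. $\lambda=\varrho_\lambda(0)\ge\varrho_\lambda(t)$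 for all $t\ge0$ and $\lambda\in(0,\lambda_*)$; 2. for every $\varepsilon>0$ there are $\delta_\varepsilon\in(0,1)$ and $\lambda_\varepsilon\in(0,\lambda_*]$ such that $\varrho_\lambda(T)\ge\lambda(1-\varepsilon)$ whenever $0<\lambda<\lambda_\varepsilon$ and $0<T\le\delta_\varepsilon/\lambda$; 3. $\lim_{\lambda\to+0}V_0^\infty[\varrho_\lambda]=0$; 4. for some $r_0\in(0,1)$, $$\lim_{\lambda\to+0}\sup_{\omega\in\Omega}\bigl|\mathcal V[\varrho_\lambda](\omega)-U_*(\omega)\bigr|=0=\lim_{\lambda\to+0}\ \sup_{T\in(0,q[\varrho_\lambda](r_0)),\ \omega\in\Omega}\bigl|\mathcal V[(\varrho_\lambda)^T_{\rm shift}](\omega)-U_*(\omega)\bigr|.$$ -/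

import Mathlib

open Set Filter Topology MeasureTheory
open scoped NNReal ENNReal

namespace Tauberian

/-- A function is bounded in absolute value. -/
def IsBdd {X : Type*} (f : X → ℝ) : Prop := ∃ C : ℝ, ∀ x, |f x| ≤ C

/-- A dynamic system on the state set `Ω`: a nonempty set of processes `ℝ₊ → Ω` and a running
payoff `g : Ω → [0,1]` such that `t ↦ g (z t)` is Lebesgue measurable along every process `z`. -/
structure DynSystem (Ω : Type*) where
  /-- the set of processes -/
  K : Set (ℝ≥0 → Ω)
  K_nonempty : K.Nonempty
  /-- the running payoff -/
  g : Ω → ℝ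
  g_mem : ∀ ω, g ω ∈ Icc (0 : ℝ) 1
  g_meas : ∀ z ∈ K, AEMeasurable (fun t : ℝ => g (z t.toNNReal)) (volume.restrict (Ici 0))

/-- A game map takes bounded payoffs `c : K → ℝ` to bounded value functions `Ω → ℝ`; it commutes
with `c ↦ A c + B` for `A ≥ 0`, and it is monotone. The values of `V` at unbounded payoffs are
unconstrained and never used. -/
structure IsGameMap {Ω : Type*} (S : DynSystem Ω) (V : (S.K → ℝ) → Ω → ℝ) : Prop where
  bdd : ∀ c, IsBdd c → IsBdd (V c)
  affine : ∀ c, IsBdd c → ∀ A B : ℝ, 0 ≤ A →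
    V (fun z => A * c z + B) = fun ω => A * V c ω + B
  mono : ∀ c₁ c₂, IsBdd c₁ → IsBdd c₂ → (∀ z, c₁ z ≤ c₂ z) → ∀ ω, V c₁ ω ≤ V c₂ ω

/-- Probability densities on `[0,∞)`. They are represented by functions on `ℝ`, whose values at
negative arguments play no role. -/
structure IsDensity (ρ : ℝ → ℝ) : Prop where
  nonneg : ∀ t, 0 ≤ t → 0 ≤ ρ t
  integrable : IntegrableOn ρ (Ici 0)
  integral_eq : ∫ t in Ici (0 : ℝ), ρ t = 1

/-- The time shift `ρ(t + T) / ∫_T^∞ ρ`. -/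
noncomputable def shift (ρ : ℝ → ℝ) (T : ℝ) : ℝ → ℝ :=
  fun t => ρ (t + T) / ∫ s in Ioi T, ρ s

/-- The time scaling `l ρ(l t)`. -/
def scale (ρ : ℝ → ℝ) (l : ℝ) : ℝ → ℝ := fun t => l * ρ (l * t)

/-- The density of the uniform distribution on `[0,T]`. -/
noncomputable def unif (T : ℝ) : ℝ → ℝ := (Icc (0 : ℝ) T).indicator fun _ => 1 / T

/-- The density of the exponential distribution with rate `l`. -/
noncomputable def expo (l : ℝ) : ℝ → ℝ := fun t => l * Real.exp (-(l * t))

/-- Power densities: `ρ(t) = (α + β t)^{-γ}` on `[0,∞)` for some `α, β, γ > 0`. -/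
def IsPowerDensity (ρ : ℝ → ℝ) : Prop :=
  IsDensity ρ ∧ ∃ α β γ : ℝ, 0 < α ∧ 0 < β ∧ 0 < γ ∧
    ∀ t, 0 ≤ t → ρ t = 1 / (α + β * t) ^ γ

/-- Piecewise continuity on `(0,∞)`: finitely many discontinuities on every compact subinterval
of `(0,∞)`, and finite one-sided limits at every point of `(0,∞)`. -/
def IsPiecewiseContinuous (ρ : ℝ → ℝ) : Prop :=
  (∀ a b : ℝ, 0 < a → {t ∈ Icc a b | ¬ ContinuousAt ρ t}.Finite) ∧
  ∀ t : ℝ, 0 < t → (∃ y, Tendsto ρ (𝓝[<] t) (𝓝 y)) ∧ ∃ y, Tendsto ρ (𝓝[>] t) (𝓝 y)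

/-- The quantile `q[ρ](r)`: the least positive `x` with `∫_0^x ρ = r`. -/
noncomputable def quantile (ρ : ℝ → ℝ) (r : ℝ) : ℝ :=
  sInf {x : ℝ | 0 < x ∧ ∫ t in (0 : ℝ)..x, ρ t = r}

/-- The averaged payoff `c[ρ](z) = ∫_0^∞ ρ(t) g(z(t)) dt`. -/
noncomputable def payoff {Ω : Type*} (S : DynSystem Ω) (ρ : ℝ → ℝ) : S.K → ℝ :=
  fun z => ∫ t in Ici (0 : ℝ), ρ t * S.g (z.1 t.toNNReal)

/-- The value function `𝒱[ρ] = V[c[ρ]]`. -/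
noncomputable def value {Ω : Type*} (S : DynSystem Ω) (V : (S.K → ℝ) → Ω → ℝ) (ρ : ℝ → ℝ) :
    Ω → ℝ := V (payoff S ρ)

/-- The payoff `∫_0^T ρ(t) g(z(t)) dt + (∫_T^∞ ρ(t) dt) · V[c[shift of ρ by T]](z(T))`. -/
noncomputable def ddPayoff {Ω : Type*} (S : DynSystem Ω) (V : (S.K → ℝ) → Ω → ℝ)
    (ρ : ℝ → ℝ) (T : ℝ) : S.K → ℝ :=
  fun z => (∫ t in (0 : ℝ)..T, ρ t * S.g (z.1 t.toNNReal)) +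
    (∫ t in Ioi T, ρ t) * value S V (shift ρ T) (z.1 T.toNNReal)

/-- The asymptotic dynamic programming principle. -/
def AsymptoticDPP {Ω : Type*} (S : DynSystem Ω) (V : (S.K → ℝ) → Ω → ℝ) : Prop :=
  ∀ κ : ℝ, 0 < κ → ∃ γ : ℝ, 0 < γ ∧ ∀ (ν : ℝ → ℝ) (T : ℝ), IsDensity ν → 1 < T →
    eVariationOn ν (Ici 0) < ENNReal.ofReal γ → ∫ t in (0 : ℝ)..T, ν t < 1 →
    ∀ ω, |V (ddPayoff S V ν T) ω - V (payoff S ν) ω| < κ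

section Conditions

variable {Ω : Type*} (S : DynSystem Ω) (V : (S.K → ℝ) → Ω → ℝ) (U : Ω → ℝ)

/-- Condition (c): scalings of every piecewise continuous density. -/
def CondC : Prop :=
  ∀ μ : ℝ → ℝ, IsDensity μ → IsPiecewiseContinuous μ →
    TendstoUniformly (fun l : ℝ => value S V (scale μ l)) U (𝓝[>] 0)

/-- Condition (u): uniform distributions. -/
def CondU : Prop := TendstoUniformly (fun T : ℝ => value S V (unif T)) U atTop

/-- Condition (e): exponential distributions. -/
def CondE : Prop := TendstoUniformly (fun l : ℝ => value S V (expo l)) U (𝓝[>] 0)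

/-- Condition (p): time shifts of some power density. -/
def CondP : Prop :=
  ∃ ρ : ℝ → ℝ, IsPowerDensity ρ ∧
    TendstoUniformly (fun T : ℝ => value S V (shift ρ T)) U atTop

/-- Condition (q): time shifts of every power density. -/
def CondQ : Prop :=
  ∀ ρ : ℝ → ℝ, IsPowerDensity ρ →
    TendstoUniformly (fun T : ℝ => value S V (shift ρ T)) U atTop

/-- Condition (v): all families of densities `μ_l`, `0 < l < l_*`, with `sup_{t>0} μ_l(t) → 0`
and with `V_0^{q[μ_l](1-ε)}[μ_l] · q[μ_l](1-ε)` bounded in `l` for each `ε ∈ (0,1)`. -/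
def CondV : Prop :=
  ∀ (ls : ℝ) (μ : ℝ → ℝ → ℝ), 0 < ls → (∀ l ∈ Ioo 0 ls, IsDensity (μ l)) →
    Tendsto (fun l : ℝ => ⨆ t ∈ Ioi (0 : ℝ), ENNReal.ofReal (μ l t)) (𝓝[>] 0) (𝓝 0) →
    (∀ ε ∈ Ioo (0 : ℝ) 1,
      (⨆ l ∈ Ioo (0 : ℝ) ls, eVariationOn (μ l) (Ico 0 (quantile (μ l) (1 - ε))) *
        ENNReal.ofReal (quantile (μ l) (1 - ε))) < ⊤) →
    TendstoUniformly (fun l : ℝ => value S V (μ l)) U (𝓝[>] 0)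

/-- Condition (∃): existence of a suitable test family `ρ_l`, `0 < l < l_*`. -/
def CondEx : Prop :=
  ∃ (ls : ℝ) (ρ : ℝ → ℝ → ℝ), 0 < ls ∧ (∀ l ∈ Ioo 0 ls, IsDensity (ρ l)) ∧
    (∀ l ∈ Ioo 0 ls, ρ l 0 = l ∧ ∀ t, 0 ≤ t → ρ l t ≤ ρ l 0) ∧
    (∀ ε : ℝ, 0 < ε → ∃ δ ∈ Ioo (0 : ℝ) 1, ∃ lε ∈ Ioc 0 ls,
      ∀ l ∈ Ioo 0 lε, ∀ T ∈ Ioc 0 (δ / l), l * (1 - ε) ≤ ρ l T) ∧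
    Tendsto (fun l : ℝ => eVariationOn (ρ l) (Ici 0)) (𝓝[>] 0) (𝓝 0) ∧
    ∃ r₀ ∈ Ioo (0 : ℝ) 1,
      TendstoUniformly (fun l : ℝ => value S V (ρ l)) U (𝓝[>] 0) ∧
      ∀ κ : ℝ, 0 < κ → ∀ᶠ l in 𝓝[>] (0 : ℝ), ∀ T ∈ Ioo 0 (quantile (ρ l) r₀), ∀ ω,
        |value S V (shift (ρ l) T) ω - U ω| < κ

end Conditions

end Tauberian

/-!
The conditions are compared through the value `𝒱[ρ] = V[c[ρ]]`, which is nonexpansive from `L¹` to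
the sup norm because a game map is monotone and commutes with adding constants. So densities may
be modified freely as long as the change is small in `L¹`.

All conditions are equivalent to `NearlyInvariant`: for a small weight `h` and a long time step `T`,
the one-step payoff `h · (1/T) ∫_0^T g(z(t)) dt + (1 - h) · U(z(T))` has value `U` up to
`ε h + o(1)` as `T → ∞`, where `ε → 0` with the bound on `h`.

* A test family as in `CondEx` gives near invariance (`CondEx.nearlyInvariant`). On `[0, δ/l]` the
  density `ρ_l` is almost the constant `l`, so dynamic programming for `ρ_l` with `l = h/T` up to
  time `T` is the one-step operator with weight `h`, while the values of `ρ_l` and of its shift are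
  both close to `U`.
* Near invariance controls every slowly varying density
  (`NearlyInvariant.exists_abs_value_sub_le`). If `μ` has mass `1 - ε` on `[0,Q]` and variation at
  most `C/Q` there, cut `[0,Q]` into `N` equal steps, `N` depending on `ε` and `C` only. On each
  step `μ` is almost constant, so dynamic programming is almost the one-step operator, with a small
  weight. With `M_k` the mass beyond the `k`-th time and `e_k` the distance to `U` of the value of
  the `k`-th shift, `M_k e_k ≤ M_{k+1} e_{k+1} + ε (M_k - M_{k+1}) + (Q/N) v_k + o(1)`, where `v_k`
  is the variation on the step. Summation bounds `e_0` by a multiple of `ε` once `Q` is large.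
* This yields `CondV` at once, and, because Lipschitz densities are dense in `L¹`, the
  convergence along the scalings of any density whatsoever (`NearlyInvariant.tendsto_scale`), hence
  `CondC`. It also yields `CondQ`, since the time shifts of a power density are time scalings of it
  (`shift_power`).
* Conversely, the exponential density is among the densities of `CondC`, the uniform ones form a
  family as in `CondV`, and a nonincreasing density that is right-continuous at `0` gives a test
  family by scaling (`condEx_of_antitoneOn`), which applies to the exponential, uniform and power
  densities.
-/

namespace Tauberian

/-! ### Densities, their shifts and scalings -/

section Density

variable {ρ : ℝ → ℝ}

lemma IsDensity.integrableOn_Ioi (h : IsDensity ρ) {T : ℝ} (hT : 0 ≤ T) :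
    IntegrableOn ρ (Ioi T) :=
  h.integrable.mono_set fun _ hx => hT.trans (le_of_lt hx)

lemma IsDensity.intervalIntegrable (h : IsDensity ρ) {a b : ℝ} (ha : 0 ≤ a) (hab : a ≤ b) :
    IntervalIntegrable ρ volume a b :=
  (intervalIntegrable_iff_integrableOn_Ioc_of_le hab).2
    (h.integrable.mono_set fun _ hx => ha.trans hx.1.le)

lemma IsDensity.interval_add_tail (h : IsDensity ρ) {a b : ℝ} (ha : 0 ≤ a) (hab : a ≤ b) :
    (∫ t in a..b, ρ t) + ∫ t in Ioi b, ρ t = ∫ t in Ioi a, ρ t :=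
  intervalIntegral.integral_interval_add_Ioi (h.integrableOn_Ioi ha)
    (h.integrableOn_Ioi (ha.trans hab))

lemma IsDensity.integral_Ioi_zero (h : IsDensity ρ) : ∫ t in Ioi (0 : ℝ), ρ t = 1 := by
  rw [← integral_Ici_eq_integral_Ioi, h.integral_eq]

lemma IsDensity.tail_nonneg (h : IsDensity ρ) {T : ℝ} (hT : 0 ≤ T) : 0 ≤ ∫ t in Ioi T, ρ t :=
  setIntegral_nonneg measurableSet_Ioi fun t ht => h.nonneg t (hT.trans (le_of_lt ht))

lemma IsDensity.interval_nonneg (h : IsDensity ρ) {a b : ℝ} (ha : 0 ≤ a) (hab : a ≤ b) :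
    0 ≤ ∫ t in a..b, ρ t :=
  intervalIntegral.integral_nonneg hab fun t ht => h.nonneg t (ha.trans ht.1)

lemma integral_Ioi_comp_add (f : ℝ → ℝ) (a T : ℝ) :
    ∫ t in Ioi a, f (t + T) = ∫ t in Ioi (a + T), f t := by
  have := (measurePreserving_add_right volume T).setIntegral_preimage_emb
    (measurableEmbedding_addRight T) f (Ioi (a + T))
  simpa using this

lemma integral_Ioi_shift (ρ : ℝ → ℝ) (T s : ℝ) :
    ∫ t in Ioi s, shift ρ T t = (∫ t in Ioi (s + T), ρ t) / ∫ t in Ioi T, ρ t := by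
  simp only [shift, integral_div, integral_Ioi_comp_add]

lemma shift_shift (ρ : ℝ → ℝ) {T : ℝ} (hT : ∫ t in Ioi T, ρ t ≠ 0) (s : ℝ) :
    shift (shift ρ T) s = shift ρ (T + s) := by
  funext t
  have : shift (shift ρ T) s t = shift ρ T (t + s) / ∫ t in Ioi s, shift ρ T t := rfl
  rw [this, integral_Ioi_shift, shift, shift, add_comm s T, add_assoc, add_comm s T,
    div_div_div_cancel_right₀ hT]

lemma IsDensity.shift (h : IsDensity ρ) {T : ℝ} (hT : 0 ≤ T) (hpos : 0 < ∫ t in Ioi T, ρ t) :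
    IsDensity (shift ρ T) where
  nonneg t ht := div_nonneg (h.nonneg _ (by linarith)) hpos.le
  integrable := by
    have := ((measurePreserving_add_right volume T).integrableOn_comp_preimage
      (measurableEmbedding_addRight T) (f := ρ) (s := Ioi T)).2 (h.integrableOn_Ioi hT)
    rw [integrableOn_Ici_iff_integrableOn_Ioi]
    rw [preimage_add_const_Ioi, sub_self] at this
    exact Integrable.div_const this _
  integral_eq := by
    rw [integral_Ici_eq_integral_Ioi, integral_Ioi_shift, zero_add, div_self hpos.ne']

lemma IsDensity.scale (h : IsDensity ρ) {l : ℝ} (hl : 0 < l) : IsDensity (scale ρ l) where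
  nonneg t ht := mul_nonneg hl.le (h.nonneg _ (by positivity))
  integrable := by
    rw [integrableOn_Ici_iff_integrableOn_Ioi]
    refine Integrable.const_mul ((integrableOn_Ioi_comp_mul_left_iff ρ 0 hl).2 ?_) l
    simpa using h.integrableOn_Ioi le_rfl
  integral_eq := by
    rw [integral_Ici_eq_integral_Ioi]
    simp only [Tauberian.scale, integral_const_mul]
    rw [integral_comp_mul_left_Ioi ρ 0 hl]
    simp [h.integral_Ioi_zero, hl.ne']

/-- A density has a point below which its mass is a prescribed `r ∈ (0,1)`, and that point can be
chosen in `(0, b)` as soon as the mass of `[0, b]` exceeds `r`. -/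
lemma IsDensity.exists_integral_eq_of_lt (h : IsDensity ρ) {r b : ℝ} (hr : 0 < r) (hb : 0 < b)
    (hrb : r < ∫ t in (0 : ℝ)..b, ρ t) : ∃ x ∈ Ioo 0 b, ∫ t in (0 : ℝ)..x, ρ t = r := by
  have hc : ContinuousOn (fun x => ∫ t in (0 : ℝ)..x, ρ t) (Icc 0 b) := by
    have := intervalIntegral.continuousOn_primitive_interval
      (f := ρ) (μ := volume) (a := 0) (b := b) ?_
    · simpa [uIcc_of_le hb.le] using this
    · rw [uIcc_of_le hb.le]
      exact h.integrable.mono_set fun _ hx => hx.1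
  have := intermediate_value_Ioo hb.le hc
  simp only [intervalIntegral.integral_same] at this
  obtain ⟨x, hx, hx'⟩ := this ⟨hr, hrb⟩
  exact ⟨x, hx, hx'⟩

lemma IsDensity.exists_integral_eq (h : IsDensity ρ) {r : ℝ} (hr : 0 < r) (hr1 : r < 1) :
    ∃ x, 0 < x ∧ ∫ t in (0 : ℝ)..x, ρ t = r := by
  have ht := intervalIntegral_tendsto_integral_Ioi 0 (h.integrableOn_Ioi le_rfl) tendsto_id
  rw [h.integral_Ioi_zero] at ht
  obtain ⟨b, hb, hb0⟩ := ((ht.eventually (lt_mem_nhds hr1)).and (eventually_gt_atTop 0)).exists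
  obtain ⟨x, hx, hx'⟩ := h.exists_integral_eq_of_lt hr hb0 hb
  exact ⟨x, hx.1, hx'⟩

lemma quantile_le {r x : ℝ} (hx : 0 < x) (h : ∫ t in (0 : ℝ)..x, ρ t = r) : quantile ρ r ≤ x :=
  csInf_le ⟨0, fun _ hy => hy.1.le⟩ ⟨hx, h⟩

lemma IsDensity.le_quantile (h : IsDensity ρ) {r x : ℝ} (hr : 0 < r) (hr1 : r < 1)
    (hx : ∀ y, 0 < y → y ≤ x → ∫ t in (0 : ℝ)..y, ρ t < r) : x ≤ quantile ρ r := by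
  refine le_csInf (h.exists_integral_eq hr hr1) fun y hy => ?_
  by_contra! hlt
  exact (hx y hy.1 hlt.le).ne hy.2

lemma IsDensity.quantile_pos (h : IsDensity ρ) {r : ℝ} (hr : 0 < r) (hr1 : r < 1) :
    0 < quantile ρ r := by
  obtain ⟨b, hb0, hb⟩ := h.exists_integral_eq hr hr1
  obtain ⟨x, hx, hx'⟩ := h.exists_integral_eq_of_lt (r := r / 2) (by linarith) hb0 (by linarith)
  refine hx.1.trans_le (h.le_quantile hr hr1 fun y hy hyx => ?_)
  have h1 := h.interval_add_tail le_rfl hy.le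
  have h2 := h.interval_add_tail le_rfl hx.1.le
  have h3 := h.interval_add_tail hy.le hyx
  have h4 := h.interval_nonneg hy.le hyx
  linarith

lemma IsDensity.integral_quantile (h : IsDensity ρ) {r : ℝ} (hr : 0 < r) (hr1 : r < 1) :
    ∫ t in (0 : ℝ)..quantile ρ r, ρ t = r := by
  have hq := h.quantile_pos hr hr1
  have hmono : ∀ {x y}, 0 < x → x ≤ y → ∫ t in (0 : ℝ)..x, ρ t ≤ ∫ t in (0 : ℝ)..y, ρ t := by
    intro x y hx hxy
    have h1 := h.interval_add_tail le_rfl hx.le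
    have h2 := h.interval_add_tail le_rfl (hx.le.trans hxy)
    have h3 := h.interval_add_tail hx.le hxy
    have h4 := h.interval_nonneg hx.le hxy
    linarith
  obtain ⟨b, hb0, hb⟩ := h.exists_integral_eq hr hr1
  have hqb : quantile ρ r ≤ b := quantile_le hb0 hb
  refine le_antisymm ((hmono hq hqb).trans_eq hb) ?_
  by_contra! hlt
  -- a point `x` beyond the quantile with mass strictly between that of the quantile and `r`
  obtain ⟨s, hs1, hs2⟩ := exists_between hlt
  have hs0 : 0 < s := (h.interval_nonneg le_rfl hq.le).trans_lt hs1
  obtain ⟨x, hx, hxs⟩ := h.exists_integral_eq_of_lt hs0 hb0 (by rw [hb]; exact hs2)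
  have : x ≤ quantile ρ r := h.le_quantile hr hr1 fun y hy hyx =>
    (hmono hy hyx).trans_lt (hxs ▸ hs2)
  have := hmono hx.1 this
  linarith

end Density

/-! ### Total variation of real functions -/

lemma abs_sub_le_of_eVariationOn_le {f : ℝ → ℝ} {s : Set ℝ} {c : ℝ} (hc : 0 ≤ c)
    (h : eVariationOn f s ≤ ENNReal.ofReal c) {x y : ℝ} (hx : x ∈ s) (hy : y ∈ s) :
    |f x - f y| ≤ c := by
  have := (eVariationOn.edist_le f hx hy).trans h
  rw [edist_dist, Real.dist_eq] at this
  exact (ENNReal.ofReal_le_ofReal_iff hc).1 this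

lemma eVariationOn_const_mul_comp_le (f : ℝ → ℝ) {φ : ℝ → ℝ} {s t : Set ℝ} {a : ℝ} (ha : 0 ≤ a)
    (hφ : MonotoneOn φ t) (hst : MapsTo φ t s) :
    eVariationOn (fun x => a * f (φ x)) t ≤ ENNReal.ofReal a * eVariationOn f s := by
  have hl : LipschitzOnWith a.toNNReal (fun y : ℝ => a * y) univ := by
    refine LipschitzOnWith.of_dist_le_mul fun x _ y _ => ?_
    rw [Real.dist_eq, Real.dist_eq, ← mul_sub, abs_mul, abs_of_nonneg ha, Real.coe_toNNReal _ ha]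
  refine (hl.comp_eVariationOn_le (g := fun x => f (φ x)) (mapsTo_univ _ _)).trans ?_
  exact mul_le_mul_right (eVariationOn.comp_le_of_monotoneOn f φ hφ hst) _

lemma eVariationOn_Ici_le_of_antitoneOn {f : ℝ → ℝ} {a : ℝ} (hf : AntitoneOn f (Ici a))
    (h0 : ∀ t, a ≤ t → 0 ≤ f t) : eVariationOn f (Ici a) ≤ ENNReal.ofReal (f a) := by
  refine iSup_le fun p => ?_
  obtain ⟨n, u, hu, hus⟩ := p
  calc _ = ∑ i ∈ Finset.range n, ENNReal.ofReal (f (u i) - f (u (i + 1))) := by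
        refine Finset.sum_congr rfl fun i _ => ?_
        rw [edist_dist, Real.dist_eq, abs_sub_comm, abs_of_nonneg]
        exact sub_nonneg.2 (hf (hus i) (hus (i + 1)) (hu (Nat.le_succ _)))
    _ = ENNReal.ofReal (f (u 0) - f (u n)) := by
        rw [← ENNReal.ofReal_sum_of_nonneg
          (fun i _ => sub_nonneg.2 (hf (hus i) (hus (i + 1)) (hu (Nat.le_succ _)))),
          Finset.sum_range_sub' (fun i => f (u i))]
    _ ≤ _ := ENNReal.ofReal_le_ofReal (by
        linarith [hf (mem_Ici.2 le_rfl) (hus 0) (hus 0), h0 (u n) (hus n)])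

/-! ### Averaged payoffs and values -/

section Value

variable {Ω : Type*} {S : DynSystem Ω} {V : (S.K → ℝ) → Ω → ℝ} {ρ μ ν : ℝ → ℝ}

lemma DynSystem.abs_g_le (S : DynSystem Ω) (ω : Ω) : |S.g ω| ≤ 1 := by
  rw [abs_of_nonneg (S.g_mem ω).1]; exact (S.g_mem ω).2

lemma DynSystem.integrableOn_mul_g (S : DynSystem Ω) {f : ℝ → ℝ} {s : Set ℝ}
    (hs : s ⊆ Ici 0) (hf : IntegrableOn f s) (z : S.K) :
    IntegrableOn (fun t => f t * S.g (z.1 t.toNNReal)) s := by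
  have hg : AEStronglyMeasurable (fun t : ℝ => S.g (z.1 t.toNNReal)) (volume.restrict s) :=
    ((S.g_meas z.1 z.2).mono_measure (Measure.restrict_mono hs le_rfl)).aestronglyMeasurable
  exact Integrable.mul_bdd (c := 1) hf hg (ae_of_all _ fun t => S.abs_g_le _)

/-- Averaging a running payoff with values in `[0,1]` is nonexpansive from `L¹` to the sup norm. -/
lemma DynSystem.abs_integral_mul_g_le (S : DynSystem Ω) {f : ℝ → ℝ} {s : Set ℝ}
    (hs : s ⊆ Ici 0) (hf : IntegrableOn f s) (z : S.K) :
    |∫ t in s, f t * S.g (z.1 t.toNNReal)| ≤ ∫ t in s, |f t| := by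
  refine (abs_integral_le_integral_abs).trans ?_
  refine integral_mono (S.integrableOn_mul_g hs hf z).abs hf.abs fun t => ?_
  simp only [abs_mul]
  exact mul_le_of_le_one_right (abs_nonneg _) (S.abs_g_le _)

lemma IsDensity.payoff_mem (h : IsDensity ρ) (z : S.K) : payoff S ρ z ∈ Icc (0 : ℝ) 1 := by
  constructor
  · exact setIntegral_nonneg measurableSet_Ici fun t ht => mul_nonneg (h.nonneg t ht) (S.g_mem _).1
  · rw [← h.integral_eq]
    exact setIntegral_mono_on (S.integrableOn_mul_g subset_rfl h.integrable z) h.integrable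
      measurableSet_Ici fun t ht => mul_le_of_le_one_right (h.nonneg t ht) (S.g_mem _).2

lemma isBdd_of_mem_Icc {X : Type*} {f : X → ℝ} {a b : ℝ} (h : ∀ x, f x ∈ Icc a b) : IsBdd f :=
  ⟨max |a| |b|, fun x => abs_le_max_abs_abs (h x).1 (h x).2⟩

lemma IsDensity.isBdd_payoff (h : IsDensity ρ) : IsBdd (payoff S ρ) :=
  isBdd_of_mem_Icc h.payoff_mem

lemma IsGameMap.const (hV : IsGameMap S V) (B : ℝ) (ω : Ω) : V (fun _ => B) ω = B := by
  have := congrFun (hV.affine (fun _ => 0) ⟨0, by simp⟩ 0 B le_rfl) ω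
  simpa using this

lemma IsGameMap.le_add (hV : IsGameMap S V) {c₁ c₂ : S.K → ℝ} (h₁ : IsBdd c₁) (h₂ : IsBdd c₂)
    {D : ℝ} (h : ∀ z, c₁ z ≤ c₂ z + D) (ω : Ω) : V c₁ ω ≤ V c₂ ω + D := by
  have := congrFun (hV.affine c₂ h₂ 1 D zero_le_one) ω
  rw [one_mul] at this
  rw [← this]
  refine hV.mono _ _ h₁ ?_ (fun z => by simpa using h z) ω
  obtain ⟨C, hC⟩ := h₂
  exact ⟨C + |D|, fun z => by
    simp only [one_mul]; exact (abs_add_le _ _).trans (by linarith [hC z])⟩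

/-- A game map is nonexpansive for the sup norm. -/
lemma IsGameMap.abs_sub_le (hV : IsGameMap S V) {c₁ c₂ : S.K → ℝ} (h₁ : IsBdd c₁) (h₂ : IsBdd c₂)
    {D : ℝ} (h : ∀ z, |c₁ z - c₂ z| ≤ D) (ω : Ω) : |V c₁ ω - V c₂ ω| ≤ D := by
  have a := hV.le_add h₁ h₂ (D := D) (fun z => by linarith [(abs_le.1 (h z)).2]) ω
  have b := hV.le_add h₂ h₁ (D := D) (fun z => by linarith [(abs_le.1 (h z)).1]) ω
  exact abs_le.2 ⟨by linarith, by linarith⟩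

lemma IsGameMap.value_mem (hV : IsGameMap S V) (h : IsDensity ρ) (ω : Ω) :
    value S V ρ ω ∈ Icc (0 : ℝ) 1 := by
  have hc : ∀ B : ℝ, IsBdd fun _ : S.K => B := fun B => ⟨|B|, fun _ => le_rfl⟩
  constructor
  · rw [← hV.const 0 ω]
    exact hV.mono _ _ (hc 0) h.isBdd_payoff (fun z => (h.payoff_mem z).1) ω
  · rw [← hV.const 1 ω]
    exact hV.mono _ _ h.isBdd_payoff (hc 1) (fun z => (h.payoff_mem z).2) ω

lemma value_congr (h : EqOn μ ν (Ici 0)) : value S V μ = value S V ν := by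
  have : payoff S μ = payoff S ν := funext fun z =>
    setIntegral_congr_fun measurableSet_Ici fun t ht => by simp only [h ht]
  rw [value, value, this]

lemma IsGameMap.abs_value_sub_le (hV : IsGameMap S V) (hμ : IsDensity μ) (hν : IsDensity ν)
    {D : ℝ} (h : ∫ t in Ici (0 : ℝ), |μ t - ν t| ≤ D) (ω : Ω) :
    |value S V μ ω - value S V ν ω| ≤ D := by
  refine hV.abs_sub_le hμ.isBdd_payoff hν.isBdd_payoff (fun z => ?_) ω
  refine le_trans ?_ h
  have := S.abs_integral_mul_g_le subset_rfl (hμ.integrable.sub hν.integrable) z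
  simp only [Pi.sub_apply, sub_mul] at this
  rwa [integral_sub (S.integrableOn_mul_g subset_rfl hμ.integrable z)
    (S.integrableOn_mul_g subset_rfl hν.integrable z)] at this

end Value

/-! ### One step of dynamic programming with the limit value as terminal payoff -/

section OneStep

variable {Ω : Type*} (S : DynSystem Ω) (V : (S.K → ℝ) → Ω → ℝ) (U : Ω → ℝ)

/-- The payoff `h · (1/T) ∫_0^T g(z(t)) dt + (1 - h) · U(z(T))`: the average of the running payoff
over `[0,T]` with weight `h`, and the terminal payoff `U` with the remaining weight. -/
noncomputable def stepPayoff (T h : ℝ) : S.K → ℝ :=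
  fun z => (∫ t in (0 : ℝ)..T, h / T * S.g (z.1 t.toNNReal)) + (1 - h) * U (z.1 T.toNNReal)

/-- `U` is nearly a fixed point of the one-step operator: for small weights `h` and all long time
steps `T`, the defect is at most `ε h + κ`. The threshold on `h` depends on `ε` only, so that a
number of steps with total weight of order `1` accumulates an error of order `ε`. -/
def NearlyInvariant : Prop :=
  ∀ ε : ℝ, 0 < ε → ∃ δ ∈ Ioo (0 : ℝ) 1, ∀ κ : ℝ, 0 < κ → ∃ T₀ : ℝ, ∀ T, T₀ ≤ T →
    ∀ h ∈ Icc 0 δ, ∀ ω, |V (stepPayoff S U T h) ω - U ω| ≤ ε * h + κ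

variable {S V U}

/-- Replacing, on a step of length `T`, the density by a constant and the continuation value by `U`
changes the payoff by at most the sum of the two errors. -/
lemma abs_ddPayoff_sub_stepPayoff_le {ν : ℝ → ℝ} (hν : IsDensity ν) {T h a b e : ℝ} (hT : 0 < T)
    (hU : ∀ ω, U ω ∈ Icc (0 : ℝ) 1)
    (ha : ∀ t ∈ Ioc 0 T, |ν t - h / T| ≤ a)
    (hb : |(∫ t in Ioi T, ν t) - (1 - h)| ≤ b)
    (he : ∀ ω, |value S V (shift ν T) ω - U ω| ≤ e) (z : S.K) :
    |ddPayoff S V ν T z - stepPayoff S U T h z| ≤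
      T * a + b + (∫ t in Ioi T, ν t) * e := by
  have hsub : Ioc 0 T ⊆ Ici (0 : ℝ) := fun _ hx => hx.1.le
  have hi : IntegrableOn ν (Ioc 0 T) := hν.integrable.mono_set hsub
  have hc : IntegrableOn (fun _ : ℝ => h / T) (Ioc 0 T) := integrableOn_const (by simp)
  have h1 : |(∫ t in (0 : ℝ)..T, ν t * S.g (z.1 t.toNNReal)) -
      ∫ t in (0 : ℝ)..T, h / T * S.g (z.1 t.toNNReal)| ≤ T * a := by
    rw [intervalIntegral.integral_of_le hT.le, intervalIntegral.integral_of_le hT.le,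
      ← integral_sub (S.integrableOn_mul_g hsub hi z) (S.integrableOn_mul_g hsub hc z)]
    have := S.abs_integral_mul_g_le hsub (hi.sub hc) z
    simp only [Pi.sub_apply, sub_mul] at this
    refine this.trans ?_
    calc ∫ t in Ioc 0 T, |ν t - h / T| ≤ ∫ t in Ioc 0 T, a :=
          setIntegral_mono_on (hi.sub hc).abs (integrableOn_const (by simp)) measurableSet_Ioc ha
      _ = T * a := by simp [hT.le]
  have h2 := hν.tail_nonneg hT.le
  set m := ∫ t in Ioi T, ν t
  set w := value S V (shift ν T) (z.1 T.toNNReal)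
  have hu := hU (z.1 T.toNNReal)
  set u := U (z.1 T.toNNReal)
  have h3 : |m * w - (1 - h) * u| ≤ b + m * e := by
    have : m * w - (1 - h) * u = (m - (1 - h)) * u + m * (w - u) := by ring
    rw [this]
    refine (abs_add_le _ _).trans (add_le_add ?_ ?_)
    · rw [abs_mul, abs_of_nonneg hu.1]
      exact (mul_le_of_le_one_right (abs_nonneg _) hu.2).trans hb
    · rw [abs_mul, abs_of_nonneg h2]
      exact mul_le_mul_of_nonneg_left (he _) h2
  calc |ddPayoff S V ν T z - stepPayoff S U T h z|
      = |((∫ t in (0 : ℝ)..T, ν t * S.g (z.1 t.toNNReal)) -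
          ∫ t in (0 : ℝ)..T, h / T * S.g (z.1 t.toNNReal)) + (m * w - (1 - h) * u)| := by
        simp only [ddPayoff, stepPayoff, m, w, u]; congr 1; ring
    _ ≤ _ := (abs_add_le _ _).trans (by linarith)

lemma isBdd_stepPayoff (hU : ∀ ω, U ω ∈ Icc (0 : ℝ) 1) {T h : ℝ} (hT : 0 < T) :
    IsBdd (stepPayoff S U T h) := by
  refine ⟨T * |h / T| + |1 - h|, fun z => (abs_add_le _ _).trans (add_le_add ?_ ?_)⟩
  · have hc : IntegrableOn (fun _ : ℝ => h / T) (Ioc 0 T) := integrableOn_const (by simp)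
    rw [intervalIntegral.integral_of_le hT.le]
    refine (S.abs_integral_mul_g_le (fun _ hx => hx.1.le) hc z).trans ?_
    simp [hT.le]
  · rw [abs_mul, abs_of_nonneg (hU _).1]
    exact mul_le_of_le_one_right (abs_nonneg _) (hU _).2

lemma IsGameMap.isBdd_ddPayoff (hV : IsGameMap S V) {ν : ℝ → ℝ} (hν : IsDensity ν) {T : ℝ}
    (hT : 0 ≤ T) (hpos : 0 < ∫ t in Ioi T, ν t) : IsBdd (ddPayoff S V ν T) := by
  refine isBdd_of_mem_Icc (a := 0) (b := 1) fun z => ?_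
  have hsub : Ioc 0 T ⊆ Ici (0 : ℝ) := fun _ hx => hx.1.le
  have hi : IntegrableOn ν (Ioc 0 T) := hν.integrable.mono_set hsub
  have hw := hV.value_mem (hν.shift hT hpos) (z.1 T.toNNReal)
  have h1 : 0 ≤ ∫ t in (0 : ℝ)..T, ν t * S.g (z.1 t.toNNReal) :=
    intervalIntegral.integral_nonneg hT fun t ht => mul_nonneg (hν.nonneg t ht.1) (S.g_mem _).1
  have h2 : ∫ t in (0 : ℝ)..T, ν t * S.g (z.1 t.toNNReal) ≤ ∫ t in (0 : ℝ)..T, ν t := by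
    rw [intervalIntegral.integral_of_le hT, intervalIntegral.integral_of_le hT]
    exact setIntegral_mono_on (S.integrableOn_mul_g hsub hi z) hi measurableSet_Ioc
      fun t ht => mul_le_of_le_one_right (hν.nonneg t ht.1.le) (S.g_mem _).2
  have h3 := hν.interval_add_tail le_rfl hT
  rw [hν.integral_Ioi_zero] at h3
  have h4 := mul_nonneg hpos.le hw.1
  have h5 := mul_le_mul_of_nonneg_left hw.2 hpos.le
  exact ⟨by simp only [ddPayoff]; linarith, by simp only [ddPayoff]; linarith⟩

end OneStep

section Test

variable {Ω : Type*} {S : DynSystem Ω} {V : (S.K → ℝ) → Ω → ℝ} {U : Ω → ℝ}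

/-- One test family suffices for `NearlyInvariant`: since `ρ_l` is nearly the constant `l` on
`[0, δ/l]`, dynamic programming for `ρ_l` with `l = h/T` up to time `T` is the one-step operator
with weight `h`, up to a relative error. -/
lemma CondEx.nearlyInvariant (hV : IsGameMap S V) (hDPP : AsymptoticDPP S V)
    (hU : ∀ ω, U ω ∈ Icc (0 : ℝ) 1) (hE : CondEx S V U) : NearlyInvariant S V U := by
  obtain ⟨ls, ρ, -, hd, hmax, hflat, hvar, r₀, hr₀, hval, hshift⟩ := hE
  intro ε hε
  obtain ⟨δ₀, hδ₀, lε, hlε, hflat⟩ := hflat (ε / 2) (by linarith)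
  have hδpos : 0 < min δ₀ (r₀ / 2) := lt_min hδ₀.1 (by linarith [hr₀.1])
  refine ⟨min δ₀ (r₀ / 2), ⟨hδpos, (min_le_left _ _).trans_lt hδ₀.2⟩, fun κ hκ => ?_⟩
  obtain ⟨γ, hγ, hdpp⟩ := hDPP (κ / 4) (by linarith)
  have hev : ∀ᶠ l in 𝓝[>] (0 : ℝ), l < lε ∧ eVariationOn (ρ l) (Ici 0) < ENNReal.ofReal γ ∧
      (∀ ω, dist (U ω) (value S V (ρ l) ω) < κ / 4) ∧
      ∀ T ∈ Ioo 0 (quantile (ρ l) r₀), ∀ ω, |value S V (shift (ρ l) T) ω - U ω| < κ / 4 := by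
    filter_upwards [mem_nhdsWithin_of_mem_nhds (Iio_mem_nhds hlε.1),
      hvar.eventually (gt_mem_nhds (ENNReal.ofReal_pos.2 hγ)),
      Metric.tendstoUniformly_iff.1 hval (κ / 4) (by linarith),
      hshift (κ / 4) (by linarith)] with l h1 h2 h3 h4
    exact ⟨h1, h2, h3, h4⟩
  obtain ⟨l₁, hl₁, hl₁sub⟩ := mem_nhdsGT_iff_exists_Ioo_subset.1 hev
  have hl₁ : 0 < l₁ := hl₁
  refine ⟨2 + 1 / l₁, fun T hT => ?_⟩
  have hT1 : 1 < T := by have : 0 < 1 / l₁ := by positivity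
                         linarith
  have hT0 : 0 < T := by linarith
  have hpos : ∀ h, 0 < h → h ≤ min δ₀ (r₀ / 2) → ∀ ω,
      |V (stepPayoff S U T h) ω - U ω| ≤ ε * h + 3 * (κ / 4) := by
    intro h hh hhδ ω
    have hhδ₀ : h ≤ δ₀ := hhδ.trans (min_le_left _ _)
    have hhr : h ≤ r₀ / 2 := hhδ.trans (min_le_right _ _)
    have hlpos : 0 < h / T := by positivity
    have hl : h / T < l₁ := by
      rw [div_lt_iff₀ hT0]
      have : 1 / l₁ < T := by linarith
      rw [div_lt_iff₀ hl₁] at this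
      linarith [hδ₀.2]
    have hlT : h / T * T = h := div_mul_cancel₀ _ hT0.ne'
    obtain ⟨a1, a2, a3, a4⟩ := hl₁sub ⟨hlpos, hl⟩
    set l := h / T with hldef
    have hlls : l ∈ Ioo 0 ls := ⟨hlpos, a1.trans_le hlε.2⟩
    have hd := hd l hlls
    obtain ⟨m1, m2⟩ := hmax l hlls
    rw [m1] at m2
    have hlow : ∀ t ∈ Ioc 0 T, l * (1 - ε / 2) ≤ ρ l t := fun t ht =>
      hflat l ⟨hlpos, a1⟩ t ⟨ht.1, ht.2.trans (by rw [le_div_iff₀ hlpos]; linarith)⟩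
    have hint := hd.intervalIntegrable le_rfl hT0.le
    have hup : ∀ y, 0 ≤ y → ∫ t in (0 : ℝ)..y, ρ l t ≤ l * y := by
      intro y hy
      have := intervalIntegral.integral_mono_on hy (hd.intervalIntegrable le_rfl hy)
        (intervalIntegrable_const (c := l)) (fun t ht => m2 t ht.1)
      simpa [mul_comm] using this
    have hlo : h * (1 - ε / 2) ≤ ∫ t in (0 : ℝ)..T, ρ l t := by
      have := intervalIntegral.integral_mono_on_of_le_Ioo hT0.le
        (intervalIntegrable_const (c := l * (1 - ε / 2))) hint
        (fun t ht => hlow t ⟨ht.1, ht.2.le⟩)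
      rw [intervalIntegral.integral_const, smul_eq_mul, sub_zero] at this
      calc h * (1 - ε / 2) = T * (l * (1 - ε / 2)) := by rw [← hlT]; ring
        _ ≤ _ := this
    have hup1 := hup T hT0.le
    rw [hlT] at hup1
    have htail := hd.interval_add_tail le_rfl hT0.le
    rw [hd.integral_Ioi_zero] at htail
    have hlt1 : ∫ t in (0 : ℝ)..T, ρ l t < 1 := by linarith [hδ₀.2]
    -- as `ρ_l ≤ l`, the mass on `[0, y]` is at most `l y`, which stays below `r₀` a little past `T`
    have hTq : T < quantile (ρ l) r₀ := by
      refine lt_of_lt_of_le (b := r₀ / (2 * l) * (3 / 2)) ?_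
        (hd.le_quantile hr₀.1 hr₀.2 fun y hy hyx => ?_)
      · have : T ≤ r₀ / (2 * l) := by rw [le_div_iff₀ (by positivity)]; linarith
        linarith
      · have h1 : l * y ≤ l * (r₀ / (2 * l) * (3 / 2)) := mul_le_mul_of_nonneg_left hyx hlpos.le
        have h2 : l * (r₀ / (2 * l) * (3 / 2)) = r₀ * (3 / 4) := by field_simp; norm_num
        linarith [hup y hy.le, hr₀.1]
    have b1 := hdpp (ρ l) T hd hT1 a2 hlt1 ω
    have b2 := a3 ω
    rw [Real.dist_eq] at b2
    have b3 : |V (ddPayoff S V (ρ l) T) ω - V (stepPayoff S U T h) ω| ≤ ε * h + κ / 4 := by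
      refine hV.abs_sub_le (hV.isBdd_ddPayoff hd hT0.le (by linarith))
        (isBdd_stepPayoff hU hT0) (fun z => ?_) ω
      refine (abs_ddPayoff_sub_stepPayoff_le hd (h := h) (a := l * (ε / 2)) (b := h * (ε / 2))
        (e := κ / 4) hT0 hU ?_ ?_ (fun ω => (a4 T ⟨hT0, hTq⟩ ω).le) z).trans ?_
      · intro t ht
        have h1 := m2 t ht.1.le
        have h2 := hlow t ht
        rw [← hldef, abs_le]
        have : 0 < l * (ε / 2) := by positivity
        constructor <;> linarith
      · have : 0 < h * (ε / 2) := by positivity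
        rw [abs_le]; constructor <;> linarith
      · have h1 : T * (l * (ε / 2)) = h * (ε / 2) := by rw [← hlT]; ring
        have h2 : (∫ t in Ioi T, ρ l t) * (κ / 4) ≤ κ / 4 := by
          refine mul_le_of_le_one_left (by linarith) ?_
          linarith [hd.interval_nonneg le_rfl hT0.le]
        linarith
    rw [value] at b2
    rw [abs_lt] at b1 b2
    rw [abs_le] at b3 ⊢
    constructor <;> linarith
  intro h hh ω
  rcases hh.1.eq_or_lt with rfl | hh0
  · -- the case of zero weight is the limit of small positive weights
    set h' := min (min δ₀ (r₀ / 2)) (κ / (4 * (ε + 2))) with hh'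
    have hp : 0 < h' := lt_min hδpos (by positivity)
    have h1 := hpos h' hp (min_le_left _ _) ω
    have h2 : (ε + 2) * h' ≤ κ / 4 := by
      have : h' ≤ κ / (4 * (ε + 2)) := min_le_right _ _
      rw [le_div_iff₀ (by positivity)] at this
      linarith
    have h3 : |V (stepPayoff S U T 0) ω - V (stepPayoff S U T h') ω| ≤ 2 * h' := by
      refine hV.abs_sub_le (isBdd_stepPayoff hU hT0) (isBdd_stepPayoff hU hT0) (fun z => ?_) ω
      have hc : IntegrableOn (fun _ : ℝ => h' / T) (Ioc 0 T) := integrableOn_const (by simp)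
      have h4 := S.abs_integral_mul_g_le (fun _ hx => hx.1.le) hc z
      rw [← intervalIntegral.integral_of_le hT0.le] at h4
      have h5 : ∫ t in Ioc 0 T, |h' / T| = h' := by
        rw [abs_of_pos (by positivity)]
        simp [hT0.le, mul_div_cancel₀, hT0.ne']
      rw [h5] at h4
      have hu := hU (z.1 T.toNNReal)
      have h6 : 0 ≤ h' * U (z.1 T.toNNReal) := mul_nonneg hp.le hu.1
      have h7 : h' * U (z.1 T.toNNReal) ≤ h' := mul_le_of_le_one_right hp.le hu.2
      simp only [stepPayoff, zero_div, zero_mul, intervalIntegral.integral_zero]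
      rw [abs_le] at h4 ⊢
      constructor <;> linarith
    rw [abs_le] at h1 h3 ⊢
    constructor <;> linarith
  · linarith [hpos h hh0 hh.2 ω]

end Test

/-! ### Densities of small variation have values close to `U` -/

lemma IsDensity.le_of_eVariationOn_Icc_le {μ : ℝ → ℝ} (hμ : IsDensity μ) {Q C : ℝ} (hQ : 0 < Q)
    (hC : 0 ≤ C) (hvar : eVariationOn μ (Icc 0 Q) ≤ ENNReal.ofReal (C / Q)) {t : ℝ}
    (ht : t ∈ Icc 0 Q) : μ t ≤ (C + 1) / Q := by
  have h1 : ∫ s in (0 : ℝ)..Q, (μ t - C / Q) ≤ ∫ s in (0 : ℝ)..Q, μ s := by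
    refine intervalIntegral.integral_mono_on hQ.le intervalIntegrable_const
      (hμ.intervalIntegrable le_rfl hQ.le) fun s hs => ?_
    linarith [(abs_le.1 (abs_sub_le_of_eVariationOn_le (div_nonneg hC hQ.le) hvar ht hs)).2]
  have h2 := hμ.interval_add_tail le_rfl hQ.le
  rw [hμ.integral_Ioi_zero] at h2
  have h3 := hμ.tail_nonneg hQ.le
  rw [intervalIntegral.integral_const, smul_eq_mul, sub_zero, mul_sub, mul_div_cancel₀ _ hQ.ne']
    at h1
  rw [le_div_iff₀ hQ]
  linarith

/-- The tail of a density beyond `Q` can be replaced by a piece of constant height, so that the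
variation on all of `[0,∞)` is controlled by the variation on `[0,Q]`. -/
lemma IsDensity.exists_eqOn_Icc {μ : ℝ → ℝ} (hμ : IsDensity μ) {Q C ε : ℝ} (hQ : 0 < Q)
    (hC : 0 ≤ C) (hε : 0 < ε) (hmass : ∫ t in (0 : ℝ)..Q, μ t = 1 - ε)
    (hvar : eVariationOn μ (Icc 0 Q) ≤ ENNReal.ofReal (C / Q)) :
    ∃ ν, IsDensity ν ∧ EqOn ν μ (Icc 0 Q) ∧ ∫ t in Ici (0 : ℝ), |μ t - ν t| ≤ 2 * ε ∧
      eVariationOn ν (Ici 0) ≤ ENNReal.ofReal ((3 * C + 2) / Q) := by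
  -- the height of the added piece bounds `μ` on `[0,Q]`, so that the new function increases at `Q`
  have hb : 0 < (C + 1) / Q := by positivity
  set b := (C + 1) / Q with hbdef
  have hL : 0 < ε / b := by positivity
  set L := ε / b with hLdef
  have hLb : b * L = ε := mul_div_cancel₀ _ hb.ne'
  have hiQ : Integrable ((Icc 0 Q).indicator μ) :=
    (integrable_indicator_iff measurableSet_Icc).2 (hμ.integrable.mono_set fun _ h => h.1)
  have hib : Integrable ((Ioc Q (Q + L)).indicator fun _ : ℝ => b) :=
    (integrable_indicator_iff measurableSet_Ioc).2 (integrableOn_const (by simp))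
  have hit : Integrable ((Ioi Q).indicator μ) :=
    (integrable_indicator_iff measurableSet_Ioi).2 (hμ.integrableOn_Ioi hQ.le)
  have hIb : ∫ t in Ici (0 : ℝ), (Ioc Q (Q + L)).indicator (fun _ : ℝ => b) t = ε := by
    rw [setIntegral_indicator measurableSet_Ioc,
      inter_eq_self_of_subset_right (s := Ici 0) (t := Ioc Q (Q + L))
        fun x hx => hQ.le.trans hx.1.le]
    simp [hL.le, ← hLb, mul_comm]
  have hIQ : ∫ t in Ici (0 : ℝ), (Icc 0 Q).indicator μ t = 1 - ε := by
    rw [setIntegral_indicator measurableSet_Icc, inter_eq_self_of_subset_right fun x hx => hx.1,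
      integral_Icc_eq_integral_Ioc, ← intervalIntegral.integral_of_le hQ.le, hmass]
  have hIt : ∫ t in Ici (0 : ℝ), (Ioi Q).indicator μ t = ε := by
    rw [setIntegral_indicator measurableSet_Ioi,
      inter_eq_self_of_subset_right (s := Ici 0) (t := Ioi Q)
        fun x hx => hQ.le.trans (le_of_lt hx)]
    have := hμ.interval_add_tail le_rfl hQ.le
    rw [hμ.integral_Ioi_zero] at this
    linarith
  have hval : ∀ t, 0 ≤ t → (Icc 0 Q).indicator μ t + (Ioc Q (Q + L)).indicator (fun _ => b) t =
      if t ≤ Q then μ t else if t ≤ Q + L then b else 0 := by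
    intro t ht
    simp only [indicator, mem_Icc, mem_Ioc]
    grind
  refine ⟨fun t => (Icc 0 Q).indicator μ t + (Ioc Q (Q + L)).indicator (fun _ => b) t,
    ⟨fun t ht => ?_, (hiQ.add hib).integrableOn, ?_⟩, fun t ht => ?_, ?_, ?_⟩
  · have := hμ.nonneg t ht
    rw [hval t ht]; split_ifs <;> first | assumption | exact hb.le | exact le_rfl
  · rw [integral_add hiQ.integrableOn hib.integrableOn, hIb, hIQ]; ring
  · simp only [hval t ht.1, ht.2, if_true]
  · calc ∫ t in Ici (0 : ℝ),
          |μ t - ((Icc 0 Q).indicator μ t + (Ioc Q (Q + L)).indicator (fun _ => b) t)|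
        ≤ ∫ t in Ici (0 : ℝ),
          ((Ioi Q).indicator μ t + (Ioc Q (Q + L)).indicator (fun _ => b) t) := by
          refine setIntegral_mono_on ?_ (hit.add hib).integrableOn measurableSet_Ici fun t ht => ?_
          · exact (hμ.integrable.sub (hiQ.add hib).integrableOn).abs
          · have := hμ.nonneg t ht
            have ht : 0 ≤ t := ht
            rw [hval t ht]
            simp only [indicator, mem_Ioi, mem_Ioc]
            split_ifs <;> grind
      _ = 2 * ε := by rw [integral_add hit.integrableOn hib.integrableOn, hIb, hIt]; ring
  · rw [eVariationOn.congr (g := fun t => if t ≤ Q then μ t else if t ≤ Q + L then b else 0)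
      (s := Ici 0) (fun t ht => hval t ht)]
    set f : ℝ → ℝ := fun t => if t ≤ Q then μ t else if t ≤ Q + L then b else 0 with hf
    have hμQ := hμ.le_of_eVariationOn_Icc_le hQ hC hvar (right_mem_Icc.2 hQ.le)
    have h1 : eVariationOn f (Icc 0 Q) ≤ ENNReal.ofReal (C / Q) := by
      rw [eVariationOn.congr (g := μ) fun t ht => by simp only [hf, ht.2, if_true]]
      exact hvar
    have h2 : eVariationOn f (Icc Q (Q + L)) ≤ ENNReal.ofReal b := by
      have hm : MonotoneOn f (Icc Q (Q + L)) := by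
        intro x hx y hy hxy
        simp only [hf]
        rcases hx.1.eq_or_lt with rfl | hx1
        · have := hy.2; split_ifs <;> grind
        · have := hy.2; have := hx.2; split_ifs <;> grind
      have := hm.eVariationOn_eq (a := Q) (b := Q + L) ⟨le_rfl, by linarith⟩ ⟨by linarith, le_rfl⟩
      rw [inter_self] at this
      rw [this]
      refine ENNReal.ofReal_le_ofReal ?_
      have := hμ.nonneg Q hQ.le
      simp only [hf]
      split_ifs <;> linarith
    have h3 : eVariationOn f (Ici (Q + L)) ≤ ENNReal.ofReal b := by
      refine (eVariationOn_Ici_le_of_antitoneOn ?_ ?_).trans (ENNReal.ofReal_le_ofReal ?_)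
      · intro x hx y hy hxy
        have hx : Q + L ≤ x := hx
        simp only [hf]
        split_ifs <;> grind
      · intro t ht
        simp only [hf]
        split_ifs <;> grind
      · simp only [hf]
        split_ifs <;> grind
    have hu : Ici (0 : ℝ) = Icc 0 Q ∪ (Icc Q (Q + L) ∪ Ici (Q + L)) := by
      rw [Icc_union_Ici_eq_Ici (by linarith), Icc_union_Ici_eq_Ici hQ.le]
    have hu2 : Icc Q (Q + L) ∪ Ici (Q + L) = Ici Q := Icc_union_Ici_eq_Ici (by linarith)
    rw [hu, eVariationOn.union f (x := Q) (isGreatest_Icc hQ.le) (hu2 ▸ isLeast_Ici),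
      eVariationOn.union f (x := Q + L) (isGreatest_Icc (by linarith)) isLeast_Ici]
    refine (add_le_add h1 (add_le_add h2 h3)).trans ?_
    rw [← ENNReal.ofReal_add hb.le hb.le, ← ENNReal.ofReal_add (by positivity) (by positivity)]
    refine ENNReal.ofReal_le_ofReal (le_of_eq ?_)
    rw [hbdef]; ring

section Core

variable {Ω : Type*} {S : DynSystem Ω} {V : (S.K → ℝ) → Ω → ℝ} {U : Ω → ℝ}

/-- One step of the backward recursion: dynamic programming for `ν` up to time `T`, compared with
the one-step operator of the same weight. -/
lemma abs_value_sub_le_of_step (hV : IsGameMap S V) (hU : ∀ ω, U ω ∈ Icc (0 : ℝ) 1)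
    {ν : ℝ → ℝ} (hν : IsDensity ν) {T a e κ η : ℝ} (hT : 0 < T) (hpos : 0 < ∫ t in Ioi T, ν t)
    (hosc : ∀ s ∈ Icc 0 T, ∀ t ∈ Icc 0 T, |ν s - ν t| ≤ a)
    (hdpp : ∀ ω, |V (ddPayoff S V ν T) ω - value S V ν ω| ≤ κ)
    (hstep : ∀ ω, |V (stepPayoff S U T (∫ t in (0 : ℝ)..T, ν t)) ω - U ω| ≤ η)
    (he : ∀ ω, |value S V (shift ν T) ω - U ω| ≤ e) (ω : Ω) :
    |value S V ν ω - U ω| ≤ κ + η + T * a + (∫ t in Ioi T, ν t) * e := by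
  have htail := hν.interval_add_tail le_rfl hT.le
  rw [hν.integral_Ioi_zero] at htail
  have h1 : |V (ddPayoff S V ν T) ω - V (stepPayoff S U T (∫ t in (0 : ℝ)..T, ν t)) ω| ≤
      T * a + 0 + (∫ t in Ioi T, ν t) * e := by
    refine hV.abs_sub_le (hV.isBdd_ddPayoff hν hT.le hpos) (isBdd_stepPayoff hU hT) (fun z => ?_) ω
    refine abs_ddPayoff_sub_stepPayoff_le hν hT hU (fun t ht => ?_) ?_ he z
    · -- the value at a point differs from the mean value by at most the oscillation
      have hi := hν.intervalIntegrable le_rfl hT.le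
      have h2 := intervalIntegral.norm_integral_le_of_norm_le_const (a := 0) (b := T)
        (f := fun s => ν s - ν t) (C := a) fun s hs => by
          rw [uIoc_of_le hT.le] at hs
          exact hosc s ⟨hs.1.le, hs.2⟩ t ⟨ht.1.le, ht.2⟩
      rw [intervalIntegral.integral_sub hi intervalIntegrable_const,
        intervalIntegral.integral_const, smul_eq_mul, sub_zero, Real.norm_eq_abs,
        abs_of_pos hT] at h2
      have h3 : ν t - (∫ s in (0 : ℝ)..T, ν s) / T =
          -(((∫ s in (0 : ℝ)..T, ν s) - T * ν t) / T) := by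
        field_simp; ring
      rw [h3, abs_neg, abs_div, abs_of_pos hT, div_le_iff₀ hT]
      exact h2
    · rw [abs_le]; constructor <;> linarith
  have h2 := hdpp ω
  have h3 := hstep ω
  rw [abs_le] at *
  constructor <;> linarith

/-- The backward recursion over `N` time steps of length `T`. The tail mass `M_k` times the distance
of the value of the `k`-th shift to `U` grows from step `k + 1` to step `k` by an amount whose sum
over all steps is controlled. -/
lemma abs_value_sub_le_of_steps (hV : IsGameMap S V) (hU : ∀ ω, U ω ∈ Icc (0 : ℝ) 1)
    {ν : ℝ → ℝ} (hν : IsDensity ν) {N : ℕ} {T ε κ : ℝ} (hT : 0 < T) (hε : 0 ≤ ε)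
    (hpos : 0 < ∫ t in Ioi (N * T), ν t)
    (hbv : eVariationOn ν (Icc 0 (N * T)) ≠ ⊤) (hκ : 0 ≤ κ)
    (hdpp : ∀ k < N, ∀ ω,
      |V (ddPayoff S V (shift ν (k * T)) T) ω - value S V (shift ν (k * T)) ω| ≤ κ)
    (hstep : ∀ k < N, ∀ ω, |V (stepPayoff S U T (∫ t in (0 : ℝ)..T, shift ν (k * T) t)) ω - U ω| ≤
      ε * (∫ t in (0 : ℝ)..T, shift ν (k * T) t) + κ) (ω : Ω) :
    |value S V ν ω - U ω| ≤ (∫ t in Ioi (N * T), ν t) + N * (2 * κ) + ε +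
      T * (eVariationOn ν (Icc 0 (N * T))).toReal := by
  set t : ℕ → ℝ := fun k => k * T with htdef
  have ht0 : ∀ k, 0 ≤ t k := fun k => by positivity
  have htm : Monotone t := fun i j hij => by
    simp only [htdef]; gcongr
  have hts : ∀ k, t (k + 1) = T + t k := fun k => by simp only [htdef]; push_cast; ring
  set M : ℕ → ℝ := fun k => ∫ s in Ioi (t k), ν s with hMdef
  have hM : Antitone M := fun i j hij => by
    have h1 := hν.interval_add_tail (ht0 i) (htm hij)
    have h2 := hν.interval_nonneg (ht0 i) (htm hij)
    simp only [hMdef]; linarith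
  have hM0 : M 0 = 1 := by simp [hMdef, htdef, hν.integral_Ioi_zero]
  set v : ℕ → ℝ := fun k => (eVariationOn ν (Icc (t k) (t (k + 1)))).toReal with hvdef
  have hfin : ∀ k < N, eVariationOn ν (Icc (t k) (t (k + 1))) ≠ ⊤ := fun k hk =>
    ne_top_of_le_ne_top hbv (eVariationOn.mono ν (Icc_subset_Icc (ht0 k) (htm hk)))
  have hpos : 0 < M N := hpos
  have hMpos : ∀ k ≤ N, 0 < M k := fun k hk => hpos.trans_le (hM hk)
  have hdens : ∀ k ≤ N, IsDensity (shift ν (t k)) := fun k hk => hν.shift (ht0 k) (hMpos k hk)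
  have key : ∀ k ≤ N, ∀ ω, M k * |value S V (shift ν (t k)) ω - U ω| ≤
      M N + ∑ i ∈ Finset.Ico k N, (2 * κ + ε * (M i - M (i + 1)) + T * v i) := by
    intro k hk
    induction hk using Nat.decreasingInduction with
    | self =>
      intro ω
      have h1 := hV.value_mem (hdens N le_rfl) ω
      have h2 := hU ω
      simp only [Finset.Ico_self, Finset.sum_empty, add_zero]
      exact mul_le_of_le_one_right hpos.le
        (abs_le.2 ⟨by linarith [h1.1, h2.2], by linarith [h1.2, h2.1]⟩)
    | of_succ k hk ih =>
      intro ω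
      have p0 := hMpos k hk.le
      have p1 := hMpos (k + 1) hk
      have htail : ∫ s in Ioi T, shift ν (t k) s = M (k + 1) / M k := by
        rw [integral_Ioi_shift, ← hts]
      have hmass : ∫ s in (0 : ℝ)..T, shift ν (t k) s = 1 - M (k + 1) / M k := by
        have h1 := (hdens k hk.le).interval_add_tail le_rfl hT.le
        rw [(hdens k hk.le).integral_Ioi_zero, htail] at h1
        linarith
      have hosc : ∀ x ∈ Icc 0 T, ∀ y ∈ Icc 0 T,
          |shift ν (t k) x - shift ν (t k) y| ≤ v k / M k := by
        intro x hx y hy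
        have h1 := abs_sub_le_of_eVariationOn_le (f := ν) (s := Icc (t k) (t (k + 1))) (c := v k)
          ENNReal.toReal_nonneg (ENNReal.ofReal_toReal (hfin k hk)).ge
          (x := x + t k) (y := y + t k)
          ⟨by linarith [hx.1], by linarith [hts k, hx.2]⟩
          ⟨by linarith [hy.1], by linarith [hts k, hy.2]⟩
        have h2 : shift ν (t k) x - shift ν (t k) y = (ν (x + t k) - ν (y + t k)) / M k := by
          simp only [shift, hMdef]; ring
        rw [h2, abs_div, abs_of_pos p0]
        gcongr
      have h1 := abs_value_sub_le_of_step hV hU (hdens k hk.le) hT (by rw [htail]; positivity)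
        hosc (hdpp k hk) (hstep k hk) (e := (M N + ∑ i ∈ Finset.Ico (k + 1) N,
          (2 * κ + ε * (M i - M (i + 1)) + T * v i)) / M (k + 1)) (fun ω => ?_) ω
      · rw [htail, hmass] at h1
        rw [Finset.sum_eq_sum_Ico_succ_bot hk]
        set R := ∑ i ∈ Finset.Ico (k + 1) N, (2 * κ + ε * (M i - M (i + 1)) + T * v i)
        have hMk : M k ≤ 1 := hM0 ▸ hM (Nat.zero_le k)
        calc M k * |value S V (shift ν (t k)) ω - U ω|
            ≤ M k * (κ + (ε * (1 - M (k + 1) / M k) + κ) + T * (v k / M k) +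
              M (k + 1) / M k * ((M N + R) / M (k + 1))) := by gcongr
          _ = M k * (2 * κ) + ε * (M k - M (k + 1)) + T * v k + (M N + R) := by
              field_simp; ring
          _ ≤ 1 * (2 * κ) + ε * (M k - M (k + 1)) + T * v k + (M N + R) := by gcongr
          _ = _ := by ring
      · rw [shift_shift ν p0.ne', add_comm, ← hts, le_div_iff₀ p1, mul_comm]
        exact ih ω
  have h0 := key 0 (Nat.zero_le N) ω
  have hshift0 : value S V (shift ν (t 0)) = value S V ν := value_congr fun s _ => by
    simp [shift, htdef, hν.integral_Ioi_zero]
  rw [hM0, one_mul, hshift0, Nat.Ico_zero_eq_range, Finset.sum_add_distrib, Finset.sum_add_distrib,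
    Finset.sum_const, Finset.card_range, nsmul_eq_mul, ← Finset.mul_sum, ← Finset.mul_sum,
    Finset.sum_range_sub' M, hM0] at h0
  have hv : ∑ i ∈ Finset.range N, v i = (eVariationOn ν (Icc 0 (N * T))).toReal := by
    simp only [hvdef]
    rw [← ENNReal.toReal_sum (fun i hi => hfin i (Finset.mem_range.1 hi)),
      eVariationOn.sum' ν htm]
    simp [htdef]
  rw [hv] at h0
  have : ε * (1 - M N) ≤ ε := mul_le_of_le_one_right hε (by linarith)
  change _ ≤ M N + _ + _ + _
  linarith

/-- If `U` is nearly invariant under the one-step operator, then the value of a density that is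
slowly varying at its own time scale `Q` is close to `U`, uniformly over all such densities. -/
lemma NearlyInvariant.exists_abs_value_sub_le (hV : IsGameMap S V) (hDPP : AsymptoticDPP S V)
    (hU : ∀ ω, U ω ∈ Icc (0 : ℝ) 1) (hN : NearlyInvariant S V U) {ε C : ℝ} (hε : 0 < ε)
    (hC : 0 ≤ C) :
    ∃ Q₀ : ℝ, ∀ (μ : ℝ → ℝ) (Q : ℝ), IsDensity μ → Q₀ ≤ Q → ∫ t in (0 : ℝ)..Q, μ t = 1 - ε →
      eVariationOn μ (Icc 0 Q) ≤ ENNReal.ofReal (C / Q) →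
      ∀ ω, |value S V μ ω - U ω| ≤ 7 * ε := by
  obtain ⟨δ, hδ, hN⟩ := hN ε hε
  -- the number of steps: fine enough for the oscillation and for the weights of the steps
  obtain ⟨N, hNbig⟩ := exists_nat_gt ((C + 1) / ε + (C + 1) / (ε * δ))
  have hδ0 := hδ.1
  have hN0 : (0 : ℝ) < N := lt_trans (by positivity) hNbig
  have hN1 : (C + 1) / ε < N := lt_trans (lt_add_of_pos_right _ (by positivity)) hNbig
  have hN2 : (C + 1) / (ε * δ) < N := lt_trans (lt_add_of_pos_left _ (by positivity)) hNbig
  rw [div_lt_iff₀ (by positivity)] at hN1 hN2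
  obtain ⟨T₀, hT₀⟩ := hN (ε / N) (by positivity)
  obtain ⟨γ, hγ, hdpp⟩ := hDPP (ε / N) (by positivity)
  -- the first summand makes the time step `Q / N` exceed `T₀` and `1`, the second one makes the
  -- variation of all shifts smaller than `γ`
  refine ⟨N * (|T₀| + 2) + (3 * C + 2) / (ε * γ) + 1, fun μ Q hμ hQ hmass hvar ω => ?_⟩
  have q1 : 0 < (3 * C + 2) / (ε * γ) := by positivity
  have q2 : 0 ≤ N * (|T₀| + 2) := by positivity
  have hQ0 : 0 < Q := by linarith
  obtain ⟨ν, hν, heq, hdist, hνvar⟩ := hμ.exists_eqOn_Icc hQ0 hC hε hmass hvar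
  set T := Q / N with hTdef
  have hNT : N * T = Q := mul_div_cancel₀ _ hN0.ne'
  have hT2 : |T₀| + 2 ≤ T := by
    rw [hTdef, le_div_iff₀ hN0]; linarith
  have hT1 : 1 < T := by linarith [abs_nonneg T₀]
  have hTpos : 0 < T := by linarith
  have hTT : T₀ ≤ T := by linarith [le_abs_self T₀]
  have hνmass : ∫ t in (0 : ℝ)..Q, ν t = 1 - ε := by
    rw [← hmass]
    refine intervalIntegral.integral_congr fun t ht => heq ?_
    rwa [uIcc_of_le hQ0.le] at ht
  have hνtail : ∫ t in Ioi Q, ν t = ε := by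
    have := hν.interval_add_tail le_rfl hQ0.le
    rw [hν.integral_Ioi_zero] at this
    linarith
  have hνQ : eVariationOn ν (Icc 0 Q) ≤ ENNReal.ofReal (C / Q) :=
    (eVariationOn.congr heq).trans_le hvar
  have htail : ∀ k < N, ∀ s, 0 ≤ s → s ≤ T → ε ≤ ∫ t in Ioi (s + k * T), ν t := by
    intro k hk s hs0 hs
    have hk1 : (k : ℝ) + 1 ≤ N := by exact_mod_cast hk
    have h0 : 0 ≤ s + k * T := by positivity
    have h1 : s + k * T ≤ Q := by
      rw [← hNT]
      calc s + k * T ≤ T + k * T := by linarith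
        _ = (k + 1) * T := by ring
        _ ≤ _ := by gcongr
    have h2 := hν.interval_add_tail h0 h1
    have h3 := hν.interval_nonneg h0 h1
    linarith
  have hkT : ∀ k : ℕ, 0 ≤ k * T := fun k => by positivity
  have htail0 : ∀ k < N, ε ≤ ∫ t in Ioi (k * T), ν t := fun k hk => by
    simpa using htail k hk 0 le_rfl hTpos.le
  have hdens : ∀ k < N, IsDensity (shift ν (k * T)) := fun k hk =>
    hν.shift (hkT k) (hε.trans_le (htail0 k hk))
  have h1 : |value S V ν ω - U ω| ≤ (∫ t in Ioi (N * T), ν t) + N * (2 * (ε / N)) + ε +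
      T * (eVariationOn ν (Icc 0 (N * T))).toReal := by
    refine abs_value_sub_le_of_steps hV hU hν hTpos hε.le (by rw [hNT, hνtail]; exact hε)
      (by rw [hNT]; exact ne_top_of_le_ne_top ENNReal.ofReal_ne_top hνQ) (by positivity) ?_ ?_ ω
    · intro k hk ω
      refine (hdpp (shift ν (k * T)) T (hdens k hk) hT1 ?_ ?_ ω).le
      · -- the variation of the shift is at most that of `ν` over the tail mass `ε`
        have h2 := eVariationOn_const_mul_comp_le ν (φ := fun t => t + k * T) (s := Ici 0)
          (t := Ici 0) (a := (∫ t in Ioi (k * T), ν t)⁻¹)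
          (inv_nonneg.2 (hε.le.trans (htail0 k hk)))
          (fun x _ y _ hxy => by simpa using hxy) (fun x hx => add_nonneg hx (hkT k))
        have h3 : shift ν (k * T) = fun x => (∫ t in Ioi (k * T), ν t)⁻¹ * ν (x + k * T) := by
          funext x; rw [shift, div_eq_inv_mul]
        rw [h3]
        refine (h2.trans (mul_le_mul (ENNReal.ofReal_le_ofReal
          (inv_anti₀ hε (htail0 k hk))) hνvar zero_le zero_le)).trans_lt ?_
        rw [← ENNReal.ofReal_mul (by positivity), ENNReal.ofReal_lt_ofReal_iff hγ]
        have h4 : (3 * C + 2) / (ε * γ) < Q := by linarith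
        rw [div_lt_iff₀ (by positivity)] at h4
        rw [← div_eq_inv_mul, div_div, div_lt_iff₀ (by positivity)]
        linarith
      · have h2 := (hdens k hk).interval_add_tail le_rfl hTpos.le
        rw [(hdens k hk).integral_Ioi_zero, integral_Ioi_shift] at h2
        have h3 : 0 < (∫ t in Ioi (T + k * T), ν t) / ∫ t in Ioi (k * T), ν t :=
          div_pos (hε.trans_le (htail k hk T hTpos.le le_rfl)) (hε.trans_le (htail0 k hk))
        linarith
    · intro k hk ω
      refine hT₀ T hTT _ ⟨(hdens k hk).interval_nonneg le_rfl hTpos.le, ?_⟩ ω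
      have hk1 : (k : ℝ) + 1 ≤ N := by exact_mod_cast hk
      have h2 : ∀ t ∈ Icc 0 T, shift ν (k * T) t ≤ (C + 1) / Q / ε := by
        intro t ht
        have h3 : t + k * T ∈ Icc 0 Q := by
          refine ⟨add_nonneg ht.1 (hkT k), ?_⟩
          rw [← hNT]
          calc t + k * T ≤ T + k * T := by linarith [ht.2]
            _ = (k + 1) * T := by ring
            _ ≤ _ := by gcongr
        have h4 := hν.le_of_eVariationOn_Icc_le hQ0 hC hνQ h3
        have h5 := htail0 k hk
        rw [shift]
        gcongr
      have h3 := intervalIntegral.integral_mono_on hTpos.le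
        ((hdens k hk).intervalIntegrable le_rfl hTpos.le) intervalIntegrable_const h2
      rw [intervalIntegral.integral_const, smul_eq_mul, sub_zero] at h3
      refine h3.trans ?_
      have : T * ((C + 1) / Q / ε) = (C + 1) / (N * ε) := by
        rw [hTdef]; field_simp
      rw [this, div_le_iff₀ (by positivity)]
      linarith
  have h2 := hV.abs_value_sub_le hμ hν hdist ω
  have h3 : N * (2 * (ε / N)) = 2 * ε := by field_simp
  have h4 : T * (eVariationOn ν (Icc 0 (N * T))).toReal ≤ ε := by
    rw [hNT]
    have h5 : (eVariationOn ν (Icc 0 Q)).toReal ≤ C / Q :=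
      ENNReal.toReal_le_of_le_ofReal (by positivity) hνQ
    calc T * (eVariationOn ν (Icc 0 Q)).toReal ≤ T * (C / Q) := by gcongr
      _ = C / N := by rw [hTdef]; field_simp
      _ ≤ ε := by rw [div_le_iff₀ hN0]; linarith
  rw [hNT] at h1 h4
  rw [h3, hνtail] at h1
  rw [abs_le] at *
  constructor <;> linarith

end Core

/-! ### Convergence of values from near invariance -/

lemma integral_abs_scale_sub (μ ν : ℝ → ℝ) {l : ℝ} (hl : 0 < l) :
    ∫ t in Ici (0 : ℝ), |scale μ l t - scale ν l t| = ∫ t in Ici (0 : ℝ), |μ t - ν t| := by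
  simp only [scale, ← mul_sub, abs_mul, abs_of_pos hl, integral_const_mul]
  rw [integral_Ici_eq_integral_Ioi, integral_Ici_eq_integral_Ioi,
    integral_comp_mul_left_Ioi (fun t => |μ t - ν t|) 0 hl]
  simp [hl.ne']

/-- Lipschitz densities are dense in `L¹` among all densities. -/
lemma IsDensity.exists_lipschitzWith {μ : ℝ → ℝ} (hμ : IsDensity μ) {ε : ℝ} (hε : 0 < ε) :
    ∃ ν K, IsDensity ν ∧ LipschitzWith K ν ∧ ∫ t in Ici (0 : ℝ), |μ t - ν t| ≤ ε := by
  set e := min (ε / 2) (1 / 2) with he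
  have he0 : 0 < e := by positivity
  have he1 : e ≤ 1 / 2 := min_le_right _ _
  have he2 : e ≤ ε / 2 := min_le_left _ _
  have hi : Integrable ((Ici (0 : ℝ)).indicator μ) := hμ.integrable.integrable_indicator
    measurableSet_Ici
  obtain ⟨g, hgs, hgd, hg⟩ := (memLp_one_iff_integrable.2 hi).exist_eLpNorm_sub_le
    ENNReal.one_ne_top le_rfl he0
  have hgi : Integrable g := hgd.continuous.integrable_of_hasCompactSupport hgs
  have hg1 : ContDiff ℝ 1 g := hgd.of_le (by exact_mod_cast le_top)
  obtain ⟨K, hK⟩ := hg1.lipschitzWith_of_hasCompactSupport hgs one_ne_zero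
  have hf : LipschitzWith K fun t => max (g t) 0 := hK.max_const 0
  set f : ℝ → ℝ := fun t => max (g t) 0
  have hfi : IntegrableOn f (Ici 0) := hgi.pos_part.integrableOn
  have hf0 : ∀ t, 0 ≤ f t := fun t => le_max_right _ _
  have hμf : ∫ t in Ici (0 : ℝ), |μ t - f t| ≤ e := by
    have h1 : ∫ t, |(Ici (0 : ℝ)).indicator μ t - g t| ≤ e := by
      rw [eLpNorm_one_eq_lintegral_enorm,
        ← ofReal_integral_norm_eq_lintegral_enorm (hi.sub hgi)] at hg
      exact (ENNReal.ofReal_le_ofReal_iff he0.le).1 hg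
    refine le_trans ?_ h1
    refine le_trans (setIntegral_mono_on (hμ.integrable.sub hfi).abs
      (hi.sub hgi).abs.integrableOn measurableSet_Ici fun t ht => ?_)
      (setIntegral_le_integral (hi.sub hgi).abs (ae_of_all _ fun t => abs_nonneg _))
    have h0 := hμ.nonneg t ht
    simp only [Pi.sub_apply, indicator_of_mem ht, f]
    rcases le_total (g t) 0 with h | h
    · rw [max_eq_right h, abs_of_nonneg (by linarith), abs_of_nonneg (by linarith)]; linarith
    · rw [max_eq_left h]
  set m := ∫ t in Ici (0 : ℝ), f t with hm
  have hm1 : |1 - m| ≤ e := by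
    rw [← hμ.integral_eq, hm, ← integral_sub hμ.integrable hfi]
    exact abs_integral_le_integral_abs.trans hμf
  have hm0 : 0 < m := by linarith [(abs_le.1 hm1).2]
  refine ⟨fun t => m⁻¹ * f t, (m⁻¹).toNNReal * K, ⟨fun t _ => by have := hf0 t; positivity,
    hfi.const_mul _, ?_⟩, ?_, ?_⟩
  · rw [integral_const_mul, inv_mul_cancel₀ hm0.ne']
  · refine LipschitzWith.of_dist_le_mul fun x y => ?_
    have h1 := hf.dist_le_mul x y
    rw [Real.dist_eq, ← mul_sub, abs_mul, abs_of_pos (inv_pos.2 hm0), NNReal.coe_mul,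
      Real.coe_toNNReal _ (inv_pos.2 hm0).le, mul_assoc, ← Real.dist_eq]
    gcongr
  · have h1 : ∫ t in Ici (0 : ℝ), |f t - m⁻¹ * f t| ≤ e := by
      have : ∀ t, |f t - m⁻¹ * f t| = |1 - m⁻¹| * f t := fun t => by
        rw [← one_sub_mul, abs_mul, abs_of_nonneg (hf0 t)]
      simp only [this, integral_const_mul]
      rw [← hm]
      calc |1 - m⁻¹| * m = |1 - m⁻¹| * |m| := by rw [abs_of_pos hm0]
        _ = |1 - m| := by
          rw [← abs_mul, sub_mul, inv_mul_cancel₀ hm0.ne', one_mul, abs_sub_comm]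
        _ ≤ e := hm1
    have i1 : IntegrableOn (fun t => |μ t - f t|) (Ici 0) := (hμ.integrable.sub hfi).abs
    have i2 : IntegrableOn (fun t => |f t - m⁻¹ * f t|) (Ici 0) :=
      (hfi.sub (hfi.const_mul m⁻¹)).abs
    calc ∫ t in Ici (0 : ℝ), |μ t - m⁻¹ * f t|
        ≤ ∫ t in Ici (0 : ℝ), (|μ t - f t| + |f t - m⁻¹ * f t|) := by
          refine integral_mono (hμ.integrable.sub (hfi.const_mul _)).abs
            (i1.add i2) fun t => ?_
          exact abs_sub_le _ _ _
      _ ≤ ε := by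
          rw [integral_add i1 i2]
          linarith

section Limits

variable {Ω : Type*} {S : DynSystem Ω} {V : (S.K → ℝ) → Ω → ℝ} {U : Ω → ℝ}

/-- The scalings of an arbitrary density, by `L¹`-approximation with Lipschitz densities. -/
lemma NearlyInvariant.tendsto_scale (hV : IsGameMap S V) (hDPP : AsymptoticDPP S V)
    (hU : ∀ ω, U ω ∈ Icc (0 : ℝ) 1) (hN : NearlyInvariant S V U) {μ : ℝ → ℝ} (hμ : IsDensity μ) :
    TendstoUniformly (fun l : ℝ => value S V (scale μ l)) U (𝓝[>] 0) := by
  refine Metric.tendstoUniformly_iff.2 fun ε hε => ?_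
  set e := min (ε / 16) (1 / 2) with he
  have he0 : 0 < e := by positivity
  have he1 : e ≤ 1 / 2 := min_le_right _ _
  have he2 : e ≤ ε / 16 := min_le_left _ _
  obtain ⟨ν, K, hν, hK, hdist⟩ := hμ.exists_lipschitzWith he0
  obtain ⟨Q, hQ, hmass⟩ := hν.exists_integral_eq (r := 1 - e) (by linarith) (by linarith)
  have hfin : eVariationOn ν (Icc 0 Q) ≠ ⊤ := by
    have := hK.lipschitzOnWith (s := Icc 0 Q) |>.comp_eVariationOn_le (g := id) (s := Icc 0 Q)
      (mapsTo_id _)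
    rw [eVariationOn_id_Icc] at this
    exact ne_top_of_le_ne_top (ENNReal.mul_ne_top ENNReal.coe_ne_top ENNReal.ofReal_ne_top) this
  set C := (eVariationOn ν (Icc 0 Q)).toReal * Q
  have hC : 0 ≤ C := mul_nonneg ENNReal.toReal_nonneg hQ.le
  obtain ⟨Q₀, hQ₀⟩ := hN.exists_abs_value_sub_le hV hDPP hU he0 hC
  have hev : ∀ᶠ l in 𝓝[>] (0 : ℝ), l < Q / (|Q₀| + 1) :=
    mem_nhdsWithin_of_mem_nhds (Iio_mem_nhds (by positivity))
  filter_upwards [hev, self_mem_nhdsWithin] with l hl1 hl ω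
  have hl : 0 < l := hl
  have hQl : Q₀ ≤ Q / l := by
    rw [lt_div_iff₀ (by positivity)] at hl1
    rw [le_div_iff₀ hl]
    nlinarith [le_abs_self Q₀]
  have h1 := hQ₀ (scale ν l) (Q / l) (hν.scale hl) hQl ?_ ?_ ω
  · have h2 := hV.abs_value_sub_le (hμ.scale hl) (hν.scale hl)
      ((integral_abs_scale_sub μ ν hl).trans_le hdist) ω
    rw [Real.dist_eq, abs_sub_comm]
    calc |value S V (scale μ l) ω - U ω| ≤ _ := abs_sub_le _ (value S V (scale ν l) ω) _
      _ < ε := by linarith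
  · simp only [scale]
    rw [intervalIntegral.integral_const_mul, intervalIntegral.mul_integral_comp_mul_left, mul_zero,
      mul_div_cancel₀ _ hl.ne', hmass]
  · refine (eVariationOn_const_mul_comp_le ν (φ := fun t => l * t) (s := Icc 0 Q) hl.le
      (fun x _ y _ hxy => mul_le_mul_of_nonneg_left hxy hl.le) fun x hx => ?_).trans ?_
    · refine ⟨mul_nonneg hl.le hx.1, ?_⟩
      have := hx.2
      rw [le_div_iff₀ hl] at this
      linarith
    · rw [← ENNReal.ofReal_toReal hfin, ← ENNReal.ofReal_mul hl.le]
      refine ENNReal.ofReal_le_ofReal (le_of_eq ?_)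
      simp only [C]
      field_simp

lemma NearlyInvariant.condV (hV : IsGameMap S V) (hDPP : AsymptoticDPP S V)
    (hU : ∀ ω, U ω ∈ Icc (0 : ℝ) 1) (hN : NearlyInvariant S V U) : CondV S V U := by
  intro ls μ hls hd hsup hvar
  refine Metric.tendstoUniformly_iff.2 fun ε hε => ?_
  set e := min (ε / 8) (1 / 2) with he
  have he0 : 0 < e := by positivity
  have he1 : e ≤ 1 / 2 := min_le_right _ _
  have he2 : e ≤ ε / 8 := min_le_left _ _
  have hK := hvar (e / 2) ⟨by linarith, by linarith⟩
  set K := ⨆ l ∈ Ioo (0 : ℝ) ls, eVariationOn (μ l) (Ico 0 (quantile (μ l) (1 - e / 2))) *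
        ENNReal.ofReal (quantile (μ l) (1 - e / 2)) with hKdef
  obtain ⟨Q₀, hQ₀⟩ := hN.exists_abs_value_sub_le hV hDPP hU he0 (C := K.toReal)
    ENNReal.toReal_nonneg
  have hs : 0 < 1 / (2 * (|Q₀| + 1)) := by positivity
  filter_upwards [hsup.eventually (gt_mem_nhds (ENNReal.ofReal_pos.2 hs)),
    Ioo_mem_nhdsGT hls] with l hls hl ω
  have hμ := hd l hl
  have hq := hμ.quantile_pos (r := 1 - e / 2) (by linarith) (by linarith)
  have hqm := hμ.integral_quantile (r := 1 - e / 2) (by linarith) (by linarith)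
  have hqK : eVariationOn (μ l) (Ico 0 (quantile (μ l) (1 - e / 2))) *
        ENNReal.ofReal (quantile (μ l) (1 - e / 2)) ≤ K :=
    le_iSup₂ (f := fun l (_ : l ∈ Ioo (0 : ℝ) ls) =>
      eVariationOn (μ l) (Ico 0 (quantile (μ l) (1 - e / 2))) *
        ENNReal.ofReal (quantile (μ l) (1 - e / 2))) l hl
  set q := quantile (μ l) (1 - e / 2)
  -- a slightly smaller quantile, so that the closed interval below it lies in `[0, q)`
  obtain ⟨Q, hQ, hQm⟩ := hμ.exists_integral_eq_of_lt (r := 1 - e) (by linarith) hq (by linarith)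
  have hQ₀Q : Q₀ ≤ Q := by
    have hle : ∀ t ∈ Ioo 0 Q, μ l t ≤ 1 / (2 * (|Q₀| + 1)) := fun t ht =>
      ((ENNReal.ofReal_lt_ofReal_iff hs).1 ((le_iSup₂ (f := fun t (_ : t ∈ Ioi (0 : ℝ)) =>
        ENNReal.ofReal (μ l t)) t ht.1).trans_lt hls)).le
    have h1 := intervalIntegral.integral_mono_on_of_le_Ioo hQ.1.le
      (hμ.intervalIntegrable le_rfl hQ.1.le) intervalIntegrable_const hle
    rw [hQm, intervalIntegral.integral_const, smul_eq_mul, sub_zero, mul_one_div,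
      le_div_iff₀ (by positivity)] at h1
    nlinarith [le_abs_self Q₀, abs_nonneg Q₀]
  have hvarQ : eVariationOn (μ l) (Icc 0 Q) ≤ ENNReal.ofReal (K.toReal / Q) := by
    rw [ENNReal.ofReal_div_of_pos hQ.1, ENNReal.ofReal_toReal hK.ne,
      ENNReal.le_div_iff_mul_le (Or.inl (ENNReal.ofReal_pos.2 hQ.1).ne')
        (Or.inl ENNReal.ofReal_ne_top)]
    refine le_trans (mul_le_mul (eVariationOn.mono _
      (Icc_subset_Ico_right hQ.2))
      (ENNReal.ofReal_le_ofReal hQ.2.le) zero_le zero_le) hqK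
  have := hQ₀ (μ l) Q hμ hQ₀Q hQm hvarQ ω
  rw [Real.dist_eq, abs_sub_comm]
  linarith

/-- The scalings of a nonincreasing density, right-continuous at `0`, are a test family as soon as
the values of their shifts converge. -/
lemma condEx_of_antitoneOn {ρ : ℝ → ℝ} (hρ : IsDensity ρ) (hanti : AntitoneOn ρ (Ici 0))
    (hc : ContinuousWithinAt ρ (Ici 0) 0) (h0 : 0 < ρ 0) {r₀ : ℝ} (hr₀ : r₀ ∈ Ioo (0 : ℝ) 1)
    (hlim : ∀ κ : ℝ, 0 < κ → ∀ᶠ l in 𝓝[>] (0 : ℝ), ∀ T ∈ Ico 0 (quantile (scale ρ l) r₀), ∀ ω,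
      |value S V (shift (scale ρ l) T) ω - U ω| < κ) : CondEx S V U := by
  have hmap : Tendsto (fun l : ℝ => l / ρ 0) (𝓝[>] 0) (𝓝[>] 0) := by
    refine tendsto_nhdsWithin_iff.2 ⟨?_, ?_⟩
    · have : Tendsto (fun l : ℝ => l / ρ 0) (𝓝 0) (𝓝 (0 / ρ 0)) := tendsto_id.div_const _
      rw [zero_div] at this
      exact this.mono_left nhdsWithin_le_nhds
    · filter_upwards [self_mem_nhdsWithin] with l hl using div_pos hl h0
  have hd : ∀ l, 0 < l → IsDensity (scale ρ (l / ρ 0)) := fun l hl => hρ.scale (div_pos hl h0)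
  refine ⟨1, fun l => scale ρ (l / ρ 0), one_pos, fun l hl => hd l hl.1, fun l hl => ?_,
    fun ε hε => ?_, ?_, r₀, hr₀, ?_, fun κ hκ => ?_⟩
  · have hl0 : 0 < l / ρ 0 := div_pos hl.1 h0
    refine ⟨by simp [scale, h0.ne'], fun t ht => ?_⟩
    simp only [scale, mul_zero]
    exact mul_le_mul_of_nonneg_left (hanti (mem_Ici.2 le_rfl) (mem_Ici.2 (by positivity))
      (by positivity)) hl0.le
  · have h1 : ∀ᶠ t in 𝓝[≥] (0 : ℝ), ρ 0 * (1 - ε) < ρ t :=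
      hc.eventually (lt_mem_nhds (by nlinarith))
    obtain ⟨d, hd, hdsub⟩ := mem_nhdsGE_iff_exists_Ico_subset.1 h1
    have hd : 0 < d := hd
    have hm : 0 < min (1 / 2) (d * ρ 0 / 2) := lt_min (by norm_num) (by positivity)
    refine ⟨min (1 / 2) (d * ρ 0 / 2), ⟨hm, (min_le_left _ _).trans_lt (by norm_num)⟩, 1,
      ⟨one_pos, le_rfl⟩, fun l hl T hT => ?_⟩
    have hl0 := hl.1
    have h2 := hT.2
    rw [le_div_iff₀ hl.1] at h2
    have h3 : l / ρ 0 * T ∈ Ico 0 d := by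
      have := hT.1
      refine ⟨by positivity, ?_⟩
      rw [div_mul_eq_mul_div, div_lt_iff₀ h0]
      have : 0 < d * ρ 0 := by positivity
      linarith [min_le_right (1 / 2) (d * ρ 0 / 2)]
    have h4 : ρ 0 * (1 - ε) < ρ (l / ρ 0 * T) := hdsub h3
    calc l * (1 - ε) = l / ρ 0 * (ρ 0 * (1 - ε)) := by field_simp
      _ ≤ scale ρ (l / ρ 0) T := mul_le_mul_of_nonneg_left h4.le (by positivity)
  · refine tendsto_of_tendsto_of_tendsto_of_le_of_le' (h := fun l => ENNReal.ofReal l)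
      tendsto_const_nhds ?_ (Eventually.of_forall fun _ => zero_le) ?_
    · have : Tendsto (fun l : ℝ => ENNReal.ofReal l) (𝓝 0) (𝓝 (ENNReal.ofReal 0)) :=
        ENNReal.continuous_ofReal.tendsto 0
      rw [ENNReal.ofReal_zero] at this
      exact this.mono_left nhdsWithin_le_nhds
    · filter_upwards [self_mem_nhdsWithin] with l hl
      have hl0 : 0 < l / ρ 0 := div_pos hl h0
      have h1 := eVariationOn_const_mul_comp_le ρ (φ := fun t => l / ρ 0 * t) (s := Ici 0)
        (t := Ici 0) hl0.le (fun x _ y _ hxy => mul_le_mul_of_nonneg_left hxy hl0.le)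
        fun x hx => mul_nonneg hl0.le hx
      refine h1.trans ((mul_le_mul_right
        (eVariationOn_Ici_le_of_antitoneOn hanti hρ.nonneg) _).trans_eq ?_)
      rw [← ENNReal.ofReal_mul hl0.le, div_mul_cancel₀ _ h0.ne']
  · refine Metric.tendstoUniformly_iff.2 fun κ hκ => ?_
    filter_upwards [hmap.eventually (hlim κ hκ), self_mem_nhdsWithin] with l h1 hl ω
    have h2 := h1 0 ⟨le_rfl, (hd l hl).quantile_pos hr₀.1 hr₀.2⟩ ω
    have h3 : value S V (shift (scale ρ (l / ρ 0)) 0) = value S V (scale ρ (l / ρ 0)) :=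
      value_congr fun s _ => by simp [shift, (hd l hl).integral_Ioi_zero]
    rw [Real.dist_eq, abs_sub_comm, ← h3]
    exact h2
  · filter_upwards [hmap.eventually (hlim κ hκ)] with l h1 T hT ω using h1 T ⟨hT.1.le, hT.2⟩ ω

end Limits

/-! ### Exponential densities -/

lemma isDensity_expo_one : IsDensity (expo 1) where
  nonneg t _ := by simp only [expo]; positivity
  integrable := by
    rw [integrableOn_Ici_iff_integrableOn_Ioi]
    have : expo 1 = fun t => Real.exp (-t) := by funext t; simp [expo]
    rw [this]
    exact integrableOn_exp_neg_Ioi 0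
  integral_eq := by
    rw [integral_Ici_eq_integral_Ioi]
    simpa [expo] using integral_exp_neg_Ioi_zero

lemma scale_expo_one (l : ℝ) : scale (expo 1) l = expo l := by
  funext t; simp [scale, expo]

/-- Exponential densities are invariant under time shifts. -/
lemma shift_expo {l : ℝ} (hl : 0 < l) (T : ℝ) : shift (expo l) T = expo l := by
  have h1 : ∀ t, expo l (t + T) = Real.exp (-(l * T)) * expo l t := fun t => by
    simp only [expo, mul_add, neg_add, Real.exp_add]; ring
  have h2 : ∫ s in Ioi T, expo l s = Real.exp (-(l * T)) := by
    have := integral_Ioi_comp_add (expo l) 0 T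
    rw [zero_add] at this
    simp only [← this, h1, integral_const_mul]
    rw [← scale_expo_one, (isDensity_expo_one.scale hl).integral_Ioi_zero, mul_one]
  funext t
  rw [shift, h1, h2, mul_div_cancel_left₀ _ (Real.exp_pos _).ne']

/-! ### Uniform densities -/

lemma unif_of_le {R t : ℝ} (ht : 0 ≤ t) (htR : t ≤ R) : unif R t = 1 / R :=
  indicator_of_mem (show t ∈ Icc 0 R from ⟨ht, htR⟩) _

lemma unif_of_gt {R t : ℝ} (htR : R < t) : unif R t = 0 :=
  indicator_of_notMem (fun h => htR.not_ge h.2) _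

lemma integral_Ioi_unif {R T : ℝ} (hT : 0 ≤ T) (hTR : T ≤ R) :
    ∫ s in Ioi T, unif R s = (R - T) / R := by
  have : Ioi T ∩ Icc 0 R = Ioc T R := by
    ext x; simp only [mem_inter_iff, mem_Ioi, mem_Icc, mem_Ioc]
    exact ⟨fun h => ⟨h.1, h.2.2⟩, fun h => ⟨h.1, hT.trans h.1.le, h.2⟩⟩
  simp only [unif]
  rw [setIntegral_indicator measurableSet_Icc, this]
  simp [hTR, div_eq_mul_inv]

lemma isDensity_unif {R : ℝ} (hR : 0 < R) : IsDensity (unif R) where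
  nonneg t _ := indicator_nonneg (fun _ _ => by positivity) t
  integrable := ((integrable_indicator_iff measurableSet_Icc).2
    (integrableOn_const (by simp))).integrableOn
  integral_eq := by
    rw [integral_Ici_eq_integral_Ioi, integral_Ioi_unif le_rfl hR.le, sub_zero, div_self hR.ne']

lemma scale_unif_one {l : ℝ} (hl : 0 < l) : scale (unif 1) l = unif (1 / l) := by
  funext t
  have : l * t ∈ Icc (0 : ℝ) 1 ↔ t ∈ Icc 0 (1 / l) := by
    simp only [mem_Icc, le_div_iff₀ hl, mul_nonneg_iff_of_pos_left hl, mul_comm]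
  by_cases h : t ∈ Icc 0 (1 / l)
  · rw [scale, unif, unif, indicator_of_mem h, indicator_of_mem (this.2 h)]
    simp
  · rw [scale, unif, unif, indicator_of_notMem h, indicator_of_notMem (mt this.1 h), mul_zero]

lemma shift_unif {R T : ℝ} (hT : 0 ≤ T) (hTR : T < R) :
    EqOn (shift (unif R) T) (unif (R - T)) (Ici 0) := by
  intro t ht
  have ht : 0 ≤ t := ht
  have hR : R ≠ 0 := by linarith
  have hRT : R - T ≠ 0 := by linarith
  rw [shift, integral_Ioi_unif hT hTR.le]
  rcases le_or_gt t (R - T) with h | h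
  · rw [unif_of_le (by linarith) (by linarith), unif_of_le ht h]
    field_simp
  · rw [unif_of_gt (by linarith), unif_of_gt h, zero_div]

lemma quantile_unif_le {R r : ℝ} (hR : 0 < R) (hr : r ∈ Ioo (0 : ℝ) 1) :
    quantile (unif R) r ≤ r * R := by
  have h0 : 0 < r * R := mul_pos hr.1 hR
  have h1 : r * R ≤ R := mul_le_of_le_one_left hR.le hr.2.le
  refine quantile_le h0 ?_
  have := (isDensity_unif hR).interval_add_tail le_rfl h0.le
  rw [integral_Ioi_unif h0.le h1, (isDensity_unif hR).integral_Ioi_zero] at this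
  have h2 : (R - r * R) / R = 1 - r := by field_simp
  linarith

/-! ### Power densities -/

section Power

variable {ρ : ℝ → ℝ} {α β γ : ℝ}

/-- The normalized time shifts of a power density `(α + β t)^{-γ}` are time scalings of it, since
`α + β (t + T) = c (α + β t / c)` with `c = (α + β T) / α`. -/
lemma shift_power (hρ : IsDensity ρ) (hα : 0 < α) (hβ : 0 < β)
    (h : ∀ t, 0 ≤ t → ρ t = 1 / (α + β * t) ^ γ) {T : ℝ} (hT : 0 ≤ T) :
    EqOn (shift ρ T) (scale ρ (α / (α + β * T))) (Ici 0) ∧ 0 < ∫ s in Ioi T, ρ s := by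
  have hβT : 0 ≤ β * T := by positivity
  set l := α / (α + β * T) with hl
  have hl0 : 0 < l := by positivity
  have key : ∀ t, 0 ≤ t → ρ (t + T) = l ^ γ * ρ (l * t) := by
    intro t ht
    have h1 : 0 < α + β * (t + T) := by positivity
    have h2 : α + β * (l * t) = l * (α + β * (t + T)) := by rw [hl]; field_simp; ring
    rw [h _ (by positivity), h _ (by positivity), h2, Real.mul_rpow hl0.le h1.le]
    have h3 : 0 < l ^ γ := by positivity
    field_simp
  have hint : ∫ s in Ioi T, ρ s = l ^ γ * l⁻¹ := by
    have h1 := integral_Ioi_comp_add ρ 0 T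
    rw [zero_add] at h1
    rw [← h1, setIntegral_congr_fun measurableSet_Ioi fun t ht => key t (le_of_lt ht),
      integral_const_mul, integral_comp_mul_left_Ioi ρ 0 hl0]
    simp [hρ.integral_Ioi_zero]
  have hlγ : 0 < l ^ γ := by positivity
  refine ⟨fun t ht => ?_, by rw [hint]; positivity⟩
  rw [shift, scale, hint, key t ht]
  field_simp

lemma isPowerDensity_one_add_rpow_neg_two : IsPowerDensity fun t => 1 / (1 + 1 * t) ^ (2 : ℝ) := by
  have heq : EqOn (fun t : ℝ => 1 / (1 + 1 * t) ^ (2 : ℝ)) (fun t => (t + 1) ^ (-2 : ℝ))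
      (Ioi 0) := fun t ht => by
    have ht : 0 < t := ht
    simp only [one_mul]
    rw [add_comm 1 t, Real.rpow_neg (by positivity), one_div]
  refine ⟨⟨fun t ht => by positivity, ?_, ?_⟩, 1, 1, 2, one_pos, one_pos, two_pos, fun _ _ => rfl⟩
  · rw [integrableOn_Ici_iff_integrableOn_Ioi]
    exact (integrableOn_congr_fun heq measurableSet_Ioi).2
      (integrableOn_add_rpow_Ioi_of_lt (by norm_num) (by norm_num))
  · rw [integral_Ici_eq_integral_Ioi, setIntegral_congr_fun measurableSet_Ioi heq,
      integral_Ioi_comp_add (fun s => s ^ (-2 : ℝ)), zero_add,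
      integral_Ioi_rpow_of_lt (by norm_num) one_pos]
    norm_num

end Power

/-! ### The implications between the conditions -/

section Implications

variable {Ω : Type*} {S : DynSystem Ω} {V : (S.K → ℝ) → Ω → ℝ} {U : Ω → ℝ}

lemma NearlyInvariant.condQ (hV : IsGameMap S V) (hDPP : AsymptoticDPP S V)
    (hU : ∀ ω, U ω ∈ Icc (0 : ℝ) 1) (hN : NearlyInvariant S V U) : CondQ S V U := by
  rintro ρ ⟨hρ, α, β, γ, hα, hβ, -, h⟩
  have ht : Tendsto (fun T : ℝ => α / (α + β * T)) atTop (𝓝[>] 0) := by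
    have h1 : Tendsto (fun T : ℝ => α + β * T) atTop atTop :=
      tendsto_atTop_add_const_left _ _ (tendsto_id.const_mul_atTop hβ)
    refine tendsto_nhdsWithin_iff.2 ⟨h1.const_div_atTop α, ?_⟩
    filter_upwards [eventually_ge_atTop 0] with T hT
    have : 0 ≤ β * T := by positivity
    exact mem_Ioi.2 (by positivity)
  intro u hu
  filter_upwards [ht.eventually (hN.tendsto_scale hV hDPP hU hρ u hu), eventually_ge_atTop 0]
    with T h1 hT ω
  rw [value_congr (shift_power hρ hα hβ h hT).1]
  exact h1 ω

lemma CondC.condE (h : CondC S V U) : CondE S V U := by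
  have hc : Continuous (expo 1) := by unfold expo; fun_prop
  have := h (expo 1) isDensity_expo_one ⟨fun a b _ => by simp [hc.continuousAt], fun t _ =>
    ⟨⟨_, (hc.tendsto t).mono_left nhdsWithin_le_nhds⟩,
      ⟨_, (hc.tendsto t).mono_left nhdsWithin_le_nhds⟩⟩⟩
  simpa only [scale_expo_one, CondE] using this

lemma CondE.condEx (h : CondE S V U) : CondEx S V U := by
  have hc : Continuous (expo 1) := by unfold expo; fun_prop
  refine condEx_of_antitoneOn isDensity_expo_one (fun x _ y _ hxy => ?_)
    hc.continuousWithinAt (by simp [expo]) (r₀ := 1 / 2) ⟨by norm_num, by norm_num⟩ fun κ hκ => ?_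
  · simp only [expo]; gcongr
  · filter_upwards [Metric.tendstoUniformly_iff.1 h κ hκ, self_mem_nhdsWithin] with l h1 hl T _ ω
    rw [scale_expo_one, shift_expo hl, abs_sub_comm, ← Real.dist_eq]
    exact h1 ω

lemma CondV.condU (h : CondV S V U) : CondU S V U := by
  have h1 := h 1 (fun l => unif (1 / l)) one_pos
    (fun l hl => isDensity_unif (one_div_pos.2 hl.1)) ?_ ?_
  · intro u hu
    have ht : Tendsto (fun T : ℝ => T⁻¹) atTop (𝓝[>] 0) := tendsto_inv_atTop_nhdsGT_zero
    filter_upwards [ht.eventually (h1 u hu)] with T hT ω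
    simpa using hT ω
  · refine tendsto_of_tendsto_of_tendsto_of_le_of_le' (h := fun l => ENNReal.ofReal l)
      tendsto_const_nhds ?_ (Eventually.of_forall fun _ => zero_le) ?_
    · have : Tendsto (fun l : ℝ => ENNReal.ofReal l) (𝓝 0) (𝓝 (ENNReal.ofReal 0)) :=
        ENNReal.continuous_ofReal.tendsto 0
      rw [ENNReal.ofReal_zero] at this
      exact this.mono_left nhdsWithin_le_nhds
    · filter_upwards [self_mem_nhdsWithin] with l hl
      have hl : 0 < l := hl
      refine iSup₂_le fun t _ => ENNReal.ofReal_le_ofReal ?_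
      rw [unif, one_div_one_div]
      exact indicator_le_self' (fun _ _ => hl.le) t
  · -- the uniform density is constant below each of its quantiles
    intro ε hε
    refine lt_of_le_of_lt (b := 0) (iSup₂_le fun l hl => ?_) ENNReal.zero_lt_top
    have hl0 := hl.1
    have hR : 0 < 1 / l := one_div_pos.2 hl0
    have hq := quantile_unif_le hR (r := 1 - ε) ⟨by linarith [hε.2], by linarith [hε.1]⟩
    rw [eVariationOn.constant_on, zero_mul]
    rintro _ ⟨x, hx, rfl⟩ _ ⟨y, hy, rfl⟩
    have hle : (1 - ε) * (1 / l) ≤ 1 / l := mul_le_of_le_one_left hR.le (by linarith [hε.1])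
    rw [unif_of_le hx.1 (by linarith [hx.2]), unif_of_le hy.1 (by linarith [hy.2])]

lemma CondU.condEx (h : CondU S V U) : CondEx S V U := by
  have h1 : ∀ t ∈ Icc (0 : ℝ) 1, unif 1 t = 1 := fun t ht => by simp [unif_of_le ht.1 ht.2]
  refine condEx_of_antitoneOn (isDensity_unif one_pos) (fun x hx y hy hxy => ?_) ?_
    (by simp [h1 0]) (r₀ := 1 / 2) ⟨by norm_num, by norm_num⟩ fun κ hκ => ?_
  · by_cases hy1 : y ≤ 1
    · rw [h1 x ⟨hx, hxy.trans hy1⟩, h1 y ⟨hy, hy1⟩]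
    · rw [unif_of_gt (not_le.1 hy1)]
      exact indicator_nonneg (fun _ _ => by norm_num) x
  · have : unif 1 =ᶠ[𝓝[≥] 0] fun _ => 1 := by
      filter_upwards [Ico_mem_nhdsGE one_pos] with t ht using h1 t ⟨ht.1, ht.2.le⟩
    exact continuousWithinAt_const.congr_of_eventuallyEq this (h1 0 (by simp))
  · obtain ⟨R₀, hR₀⟩ := eventually_atTop.1 (Metric.tendstoUniformly_iff.1 h κ hκ)
    have hev : ∀ᶠ l in 𝓝[>] (0 : ℝ), l < 1 / (2 * (|R₀| + 1)) :=
      mem_nhdsWithin_of_mem_nhds (Iio_mem_nhds (by positivity))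
    filter_upwards [hev, self_mem_nhdsWithin] with l hlR hl T hT ω
    have hl : 0 < l := hl
    rw [scale_unif_one hl] at hT ⊢
    have hR : 0 < 1 / l := one_div_pos.2 hl
    have hq := quantile_unif_le hR (r := 1 / 2) ⟨by norm_num, by norm_num⟩
    have hTR : T < 1 / 2 * (1 / l) := hT.2.trans_le hq
    rw [value_congr (shift_unif hT.1 (by linarith)), abs_sub_comm, ← Real.dist_eq]
    refine hR₀ _ ?_ ω
    rw [lt_one_div hl (by positivity)] at hlR
    linarith [le_abs_self R₀]

lemma CondQ.condP (h : CondQ S V U) : CondP S V U :=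
  ⟨_, isPowerDensity_one_add_rpow_neg_two, h _ isPowerDensity_one_add_rpow_neg_two⟩

lemma CondP.condEx (h : CondP S V U) : CondEx S V U := by
  obtain ⟨ρ, ⟨hρ, α, β, γ, hα, hβ, hγ, hρeq⟩, h⟩ := h
  have hform : EqOn ρ (fun t => 1 / (α + β * t) ^ γ) (Ici 0) := fun t ht => hρeq t ht
  refine condEx_of_antitoneOn hρ (fun x hx y hy hxy => ?_) ?_ ?_
    (r₀ := 1 / 2) ⟨by norm_num, by norm_num⟩ fun κ hκ => ?_
  · have hx0 : 0 ≤ x := hx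
    rw [hform hx, hform hy]
    dsimp only
    gcongr
  · have : ContinuousAt (fun t : ℝ => 1 / (α + β * t) ^ γ) 0 := by
      have h1 : ContinuousAt (fun t : ℝ => (α + β * t) ^ γ) 0 :=
        ContinuousAt.rpow_const (by fun_prop) (Or.inl (by simpa using hα.ne'))
      exact continuousAt_const.div h1 (by simpa using (Real.rpow_pos_of_pos hα γ).ne')
    exact this.continuousWithinAt.congr hform (hform (mem_Ici.2 le_rfl))
  · rw [hρeq 0 le_rfl, mul_zero, add_zero]
    positivity
  · obtain ⟨T₁, hT₁⟩ := eventually_atTop.1 (Metric.tendstoUniformly_iff.1 h κ hκ)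
    have hev : ∀ᶠ l in 𝓝[>] (0 : ℝ), l < α / (α + β * |T₁|) :=
      mem_nhdsWithin_of_mem_nhds (Iio_mem_nhds (by positivity))
    filter_upwards [hev, self_mem_nhdsWithin] with l hl1 hl T hT ω
    have hl : 0 < l := hl
    -- the scaling by `l` is the shift by `R`
    set R := (α / l - α) / β with hR
    have hlR : l = α / (α + β * R) := by rw [hR]; field_simp; ring
    have hR1 : |T₁| ≤ R := by
      rw [lt_div_iff₀ (by positivity)] at hl1
      rw [hR, le_div_iff₀ hβ, le_sub_iff_add_le, le_div_iff₀ hl]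
      linarith
    have hR0 : 0 ≤ R := (abs_nonneg _).trans hR1
    obtain ⟨h1, h2⟩ := shift_power hρ hα hβ hρeq hR0
    rw [← hlR] at h1
    have h3 : EqOn (shift (scale ρ l) T) (shift ρ (R + T)) (Ici 0) := by
      rw [← shift_shift ρ h2.ne']
      intro t ht
      have ht : 0 ≤ t := ht
      rw [shift, shift, h1 (mem_Ici.2 (add_nonneg ht hT.1)),
        setIntegral_congr_fun measurableSet_Ioi fun s hs =>
          h1 (mem_Ici.2 (hT.1.trans (le_of_lt hs)))]
    rw [value_congr h3, abs_sub_comm, ← Real.dist_eq]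
    exact hT₁ _ (by linarith [le_abs_self T₁, hT.1]) ω

end Implications

end Tauberian

theorem mainTheorem2 {Ω : Type*} (S : Tauberian.DynSystem Ω) (V : (S.K → ℝ) → Ω → ℝ)
    (hV : Tauberian.IsGameMap S V) (hDPP : Tauberian.AsymptoticDPP S V)
    (U : Ω → ℝ) (hU : ∀ ω, U ω ∈ Set.Icc (0 : ℝ) 1) :
    List.TFAE [Tauberian.CondC S V U, Tauberian.CondU S V U, Tauberian.CondE S V U,
      Tauberian.CondP S V U, Tauberian.CondQ S V U, Tauberian.CondV S V U,
      Tauberian.CondEx S V U] := by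
  have hN := Tauberian.CondEx.nearlyInvariant hV hDPP hU
  tfae_have 7 → 1 := fun h _ hμ _ => (hN h).tendsto_scale hV hDPP hU hμ
  tfae_have 7 → 5 := fun h => (hN h).condQ hV hDPP hU
  tfae_have 7 → 6 := fun h => (hN h).condV hV hDPP hU
  tfae_have 1 → 3 := fun h => h.condE
  tfae_have 3 → 7 := fun h => h.condEx
  tfae_have 6 → 2 := fun h => h.condU
  tfae_have 2 → 7 := fun h => h.condEx
  tfae_have 5 → 4 := fun h => h.condP
  tfae_have 4 → 7 := fun h => h.condEx
  tfae_finish
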